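/- Let $c,r,r'>0$. Put $\alpha=|r-r'|/c$, $\beta=(r+r')/c$, $\xi=\xi(t)=r^2+r'^2-c^2t^2$, let $\mathcal P_{\alpha\beta}$ be the indicator function of $[\alpha,\beta]$, let $P_n$ be the Legendre polynomials and $$Y_n^m(\theta,\phi)=\sqrt{\tfrac{2n+1}{4\pi}\tfrac{(n-m)!}{(n+m)!}}\,P_n^m(\cos\theta)e^{jm\phi},\qquad -n\le m\le n,$$ the spherical harmonics, where $j$ is the imaginary unit and $P_n^m$ are the associated Legendre functions. (1) Let $r\neq r'$, let $\mathbf r,\mathbf r'\in\mathbb R^3$ be points with spherical coordinates $(r,\theta,\phi)$ and $(r',\theta',\phi')$, where $\theta,\theta'\in[0,\pi]$, let $R=|\mathbf r-\mathbf r'|$, and let $x=\cos\gamma$, where $\gamma$ is the angle between $\mathbf r$ and $\mathbf r'$. Then the retarded potential has the expansions $$\frac{\delta(t-R/c)}{4\pi R}=\sum_{n=0}^\infty\frac{(2n+1)c}{8\pi rr'}P_n\Big(\frac{\xi}{2rr'}\Big)\mathcal P_{\alpha\beta}(t)P_n(x)=\sum_{n=0}^\infty\sum_{m=-n}^{n}\frac{c}{2rr'}P_n\Big(\frac{\xi}{2rr'}\Big)\mathcal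 P_{\alpha\beta}(t)\,Y_n^m(\theta,\phi)\,\overline{Y_n^m(\theta',\phi')},$$ where both sums over $n$ converge unconditionally in the space of tempered distributions in $t\in\mathbb R$, with its topology of pointwise convergence on Schwartz functions. (2) Let $z_n^{(1)}=j_n$ be the spherical Bessel function and $z_n^{(4)}=h_n^{(2)}=j_n-j\,y_n$ the spherical Hankel function of the second kind, and let $k=\omega/c$. If $r'\le r$, then for every $n\ge 0$ the function $-jk\,z_n^{(4)}(kr)\,\overline{z_n^{(1)}(kr')}$ of $\omega\in\mathbb R$ is square integrable, and its inverse Fourier transform $\mathcal F^{-1}[F](t)=\frac1{2\pi}\int_{-\infty}^{\infty}F(\omega)e^{j\omega t}\,d\omega$, taken in the sense of $L^2(\mathbb R)$, is $$K_n^{(0)}(r,r',t)=\frac{c}{2rr'}P_n\Big(\frac{\xi}{2rr'}\Big)\mathcal P_{\alpha\beta}(t).$$ (3) For every $n\ge 0$ the kernel $t\mapsto K_n^{(0)}(r,r',t)$ is bounded, with $|K_n^{(0)}(r,r',t)|\le \frac{c}{2rr'}$ for all $t\in\mathbb R$, and has compact support. -/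

import Mathlib

open MeasureTheory Polynomial
open scoped SchwartzMap FourierTransform

noncomputable section

namespace SphericalWave

/-- The Legendre polynomial `P_n`, by the formula of Rodrigues
`P_n = 1 / (2 ^ n n!) (d / dX) ^ n (X ^ 2 - 1) ^ n`. -/
def legendre (n : ℕ) : ℝ[X] :=
  C ((2 ^ n * (n.factorial : ℝ))⁻¹) * derivative^[n] ((X ^ 2 - 1) ^ n)

/-- The associated Legendre function of degree `n` and order `m ≥ 0`,
`P_n^m (x) = (-1) ^ m (1 - x ^ 2) ^ (m / 2) (d / dx) ^ m P_n (x)`, for `x ∈ [-1, 1]`. -/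
def assocLegendreNat (n m : ℕ) (x : ℝ) : ℝ :=
  (-1) ^ m * √(1 - x ^ 2) ^ m * (derivative^[m] (legendre n)).eval x

/-- The associated Legendre function of degree `n` and order `m ∈ {-n, …, n}`; for `m > 0`,
`P_n^{-m} = (-1) ^ m (n - m)! / (n + m)! P_n^m`. -/
def assocLegendre (n : ℕ) (m : ℤ) (x : ℝ) : ℝ :=
  if 0 ≤ m then assocLegendreNat n m.natAbs x
  else (-1) ^ m.natAbs * ((n - m.natAbs).factorial / (n + m.natAbs).factorial : ℝ) * assocLegendreNat n m.natAbs x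

/-- The spherical harmonic `Y_n^m (θ, φ)` for `-n ≤ m ≤ n`. -/
def sphericalHarmonic (n : ℕ) (m : ℤ) (θ φ : ℝ) : ℂ :=
  (√((2 * n + 1) / (4 * Real.pi) * (((n : ℤ) - m).toNat.factorial / ((n : ℤ) + m).toNat.factorial))
      * assocLegendre n m (Real.cos θ) : ℝ)
    * Complex.exp (Complex.I * m * φ)

/-- The point of `ℝ³` with spherical coordinates `(r, θ, φ)` (`θ` is the polar angle). -/
def sphericalPoint (r θ φ : ℝ) : EuclideanSpace ℝ (Fin 3) :=
  !₂[r * Real.sin θ * Real.cos φ, r * Real.sin θ * Real.sin φ, r * Real.cos θ]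

/-- `(-x) ^ n ((1 / x) d / dx) ^ n f (x)`. -/
def rayleigh (n : ℕ) (f : ℝ → ℝ) (x : ℝ) : ℝ :=
  (-x) ^ n * ((fun g : ℝ → ℝ => fun y => deriv g y / y)^[n] f) x

/-- The spherical Bessel function `j_n` of the first kind, by Rayleigh's formula for `x ≠ 0`,
and with its limit value at `0`. -/
def sphericalBesselJ (n : ℕ) (x : ℝ) : ℝ :=
  if x = 0 then (if n = 0 then 1 else 0) else rayleigh n (fun y => Real.sin y / y) x

/-- The spherical Bessel function `y_n` of the second kind, by Rayleigh's formula, for `x ≠ 0`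
(at the singular point `0` the value carries no meaning). -/
def sphericalBesselY (n : ℕ) (x : ℝ) : ℝ :=
  -rayleigh n (fun y => Real.cos y / y) x

/-- `z_n^{(1)} = j_n`. -/
def z1 (n : ℕ) (x : ℝ) : ℂ := (sphericalBesselJ n x : ℂ)

/-- `z_n^{(4)} = h_n^{(2)} = j_n - i y_n`, the spherical Hankel function of the second kind. -/
def z4 (n : ℕ) (x : ℝ) : ℂ := (sphericalBesselJ n x : ℂ) - Complex.I * (sphericalBesselY n x : ℂ)

/-- The pulse `𝒫_{αβ}`: the indicator function of `[α, β]`. -/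
def pulse (α β : ℝ) : ℝ → ℝ := (Set.Icc α β).indicator 1

/-- `P_n (ξ / (2 r r')) 𝒫_{αβ} (t)` with `ξ = r² + r'² - c² t²`, `α = |r - r'| / c` and
`β = (r + r') / c`. -/
def legendrePulse (c r r' : ℝ) (n : ℕ) (t : ℝ) : ℝ :=
  (legendre n).eval ((r ^ 2 + r' ^ 2 - c ^ 2 * t ^ 2) / (2 * r * r'))
    * pulse (|r - r'| / c) ((r + r') / c) t

/-- The kernel `K_n^{(0)} (r, r', t) = c / (2 r r') P_n (ξ / (2 r r')) 𝒫_{αβ} (t)`. -/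
def kernelZero (c r r' : ℝ) (n : ℕ) (t : ℝ) : ℝ :=
  c / (2 * r * r') * legendrePulse c r r' n t

theorem memLp_legendrePulse (c r r' : ℝ) (n : ℕ) :
    MemLp (fun t => (legendrePulse c r r' n t : ℂ)) 2 volume := by
  have hc : Continuous fun t : ℝ =>
      (((legendre n).eval ((r ^ 2 + r' ^ 2 - c ^ 2 * t ^ 2) / (2 * r * r')) : ℝ) : ℂ) :=
    Complex.continuous_ofReal.comp ((legendre n).continuous.comp (by fun_prop))
  obtain ⟨M, hM⟩ := (isCompact_Icc (a := |r - r'| / c)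
    (b := (r + r') / c)).exists_bound_of_continuousOn hc.continuousOn
  have h : MemLp (fun t : ℝ =>
      (((legendre n).eval ((r ^ 2 + r' ^ 2 - c ^ 2 * t ^ 2) / (2 * r * r')) : ℝ) : ℂ)) 2
      (volume.restrict (Set.Icc (|r - r'| / c) ((r + r') / c))) :=
    MemLp.of_bound hc.aestronglyMeasurable M
      ((ae_restrict_iff' measurableSet_Icc).2 (Filter.Eventually.of_forall hM))
  rw [← memLp_indicator_iff_restrict measurableSet_Icc] at h
  convert h using 2 with t
  by_cases ht : t ∈ Set.Icc (|r - r'| / c) ((r + r') / c) <;>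
    simp [legendrePulse, pulse, Set.indicator, ht]

/-- The function `t ↦ P_n (ξ / (2 r r')) 𝒫_{αβ} (t)` as a tempered distribution in time. -/
def legendrePulseDistribution (c r r' : ℝ) (n : ℕ) : 𝓢'(ℝ, ℂ) :=
  Lp.toTemperedDistribution ((memLp_legendrePulse c r r' n).toLp _)

/-- The retarded potential `δ (t - R / c) / (4 π R)` as a tempered distribution in `t`. -/
def retardedPotential (c R : ℝ) : 𝓢'(ℝ, ℂ) :=
  ((1 / (4 * Real.pi * R) : ℝ) : ℂ) • TemperedDistribution.delta (R / c)

/-- `f` is the inverse Fourier transform `f (t) = (1 / 2π) ∫ F (ω) exp (i ω t) dω`, in the sense of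
`L²` (the integral need not converge absolutely). Mathlib's inverse transform is
`∫ G (ν) exp (2 π i ν t) dν`, hence the substitution `ω = 2 π ν`. -/
def IsInverseFourierTransform (F f : ℝ → ℂ) : Prop :=
  ∃ (hF : MemLp (fun ν : ℝ => F (2 * Real.pi * ν)) 2 volume) (hf : MemLp f 2 volume),
    𝓕⁻ (hF.toLp _ : Lp ℂ 2 (volume : Measure ℝ)) = hf.toLp f

end SphericalWave

end

/-! The bridge between time and angle is the law of cosines. Two points at distances r and r' from
the origin, seen under an angle of cosine y, are √(r² + r'² - 2rr'y) apart, and this distance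
divided by c is the travel time. The substitution t = `travelTime c r r' y` carries [-1, 1] onto [α,
β] and turns ξ/(2rr') into y.

Expansion: tested on f, the n-th pulse becomes the n-th Legendre coefficient of one function of y,
`angularProfile` (`legendreCoeff_angularProfile`), and the retarded potential becomes a constant
times the value of that function at x = cos γ. Hence the claim is the pointwise convergence of a
Legendre series (`hasSum_legendre`). For r ≠ r' the profile is smooth around [-1, 1]; the
self-adjointness of Legendre's operator gives absolute convergence, and completeness of the P_n
identifies the sum. The addition theorem (`sum_sphericalHarmonic_mul_conj`) converts P_n(x) into
spherical harmonics; it is proved by showing that its Fourier coefficients satisfy Bonnet's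
recurrence.

Inverse transform: the transform of the kernel is computed and then inverted in L². Up to constants
it is ∫ P_n(X(s)) exp(-iks) ds with X(s) the law of cosines. This integral and the product of Bessel
and Hankel functions satisfy the same recurrence in n, with a derivative in k, and agree for n = 0
and n = 1 (`radialIntegral_eq`). Square integrability comes from Plancherel.

Bound: |P_n| ≤ 1 on [-1, 1], by an energy argument for Legendre's equation. -/

noncomputable section

namespace SphericalWave

/-! ### Recurrences, differential equation and derivatives of Legendre polynomials. -/

section LegendreAlgebra

/-- Leibniz's rule, where X has only one nonzero derivative. The truncated `k - 1` is harmless at k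
= 0 because of the factor k. -/
theorem iterate_derivative_X_mul' (k : ℕ) (p : ℝ[X]) :
    derivative^[k] (X * p) = X * derivative^[k] p + (k : ℝ[X]) * derivative^[k - 1] p := by
  induction k with
  | zero => simp
  | succ k ih =>
    rw [Function.iterate_succ_apply', ih]
    rcases k with _ | k
    · simp [derivative_mul]; ring
    · simp only [derivative_add, derivative_mul, derivative_X, Function.iterate_succ_apply',
        derivative_natCast, Nat.add_sub_cancel]
      push_cast
      ring

theorem iterate_derivative_natCast_mul' (k m : ℕ) (p : ℝ[X]) :
    derivative^[k] ((m : ℝ[X]) * p) = (m : ℝ[X]) * derivative^[k] p := by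
  induction k with
  | zero => simp
  | succ k ih => simp [Function.iterate_succ_apply', ih, derivative_mul]

/-- The unnormalized polynomials of Rodrigues' formula satisfy a first order relation. -/
theorem sq_sub_one_mul_iterate_derivative (k : ℕ) :
    ((X : ℝ[X]) ^ 2 - 1) * derivative^[k + 2] ((X ^ 2 - 1) ^ (k + 1))
      = ((k + 1) * (k + 2) : ℝ[X]) * derivative^[k] ((X ^ 2 - 1) ^ (k + 1)) := by
  set U : ℝ[X] := (X ^ 2 - 1) ^ (k + 1) with hU
  -- This is (X² - 1)U' = 2(k + 1)XU, to be differentiated k + 1 times. With X² written as two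
  -- successive factors X, the Leibniz rule for a single X suffices.
  have h0 : X * (X * derivative U) - derivative U = ((2 * (k + 1) : ℕ) : ℝ[X]) * (X * U) := by
    rw [hU, derivative_pow]
    simp only [derivative_sub, derivative_one, derivative_X_pow]
    simp
    rw [show (C 2 : ℝ[X]) = 2 from rfl]
    ring
  have h1 := congrArg (fun p => derivative^[k + 1] p) h0
  simp only [iterate_derivative_sub, iterate_derivative_natCast_mul', iterate_derivative_X_mul',
    Nat.add_sub_cancel] at h1
  have h2 : (k : ℝ[X]) * derivative^[k - 1] (derivative U) = k * derivative^[k] U := by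
    rcases k with _ | k
    · simp
    · simp [Function.iterate_succ_apply]
  rw [show derivative^[k] (derivative U) = derivative^[k + 1] U from rfl,
    show derivative^[k + 1] (derivative U) = derivative^[k + 2] U from rfl] at h1
  push_cast at h1
  linear_combination h1 - (k + 1 : ℝ[X]) * h2

theorem derivative_sq_sub_one_pow_succ (n : ℕ) :
    derivative (((X : ℝ[X]) ^ 2 - 1) ^ (n + 1))
      = ((2 * (n + 1) : ℕ) : ℝ[X]) * (X * (X ^ 2 - 1) ^ n) := by
  rw [derivative_pow]
  simp only [derivative_sub, derivative_one, derivative_X_pow]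
  simp
  rw [show (C 2 : ℝ[X]) = 2 from rfl]
  ring

/-- Differentiating (X² - 1)^(n+1) releases the factor 2(n + 1), which is exactly the ratio of two
consecutive normalizations in Rodrigues' formula. -/
theorem rodrigues_coeff_succ (n : ℕ) :
    (C ((2 ^ (n + 1) * ((n + 1).factorial : ℝ))⁻¹) : ℝ[X]) * ((2 * (n + 1) : ℕ) : ℝ[X])
      = C ((2 ^ n * (n.factorial : ℝ))⁻¹) := by
  rw [← C_eq_natCast, ← C_mul]
  congr 1
  have : (n.factorial : ℝ) ≠ 0 := by exact_mod_cast n.factorial_ne_zero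
  rw [Nat.factorial_succ]
  push_cast
  field_simp
  ring

theorem legendre_zero : legendre 0 = 1 := by simp [legendre]

theorem legendre_one : legendre 1 = X := by
  simp only [legendre, Function.iterate_one, pow_one]
  simp only [derivative_sub, derivative_one, derivative_X_pow]
  rw [sub_zero, ← mul_assoc, ← C_mul]
  norm_num

/-- Of the n + 2 derivatives of (X² - 1)^(n+1), the first gives 2(n + 1)X(X² - 1)^n and the others
pass through X by Leibniz. The later polynomial relations are combinations of this one and
`sq_sub_one_mul_derivative_legendre`. -/
theorem derivative_legendre_succ (n : ℕ) :
    derivative (legendre (n + 1)) = X * derivative (legendre n) + (n + 1 : ℝ[X]) * legendre n := by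
  simp only [legendre, derivative_C_mul, ← Function.iterate_succ_apply' derivative]
  rw [Function.iterate_succ_apply derivative (n + 1), derivative_sq_sub_one_pow_succ,
    iterate_derivative_natCast_mul', ← mul_assoc, rodrigues_coeff_succ, iterate_derivative_X_mul']
  simp only [Nat.add_sub_cancel]
  push_cast
  ring

theorem sq_sub_one_mul_derivative_legendre (n : ℕ) :
    ((X : ℝ[X]) ^ 2 - 1) * derivative (legendre n)
      = (n + 1 : ℝ[X]) * (legendre (n + 1) - X * legendre n) := by
  simp only [legendre, derivative_C_mul, ← Function.iterate_succ_apply' derivative]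
  rw [Function.iterate_succ_apply derivative n (_ ^ (n + 1)), derivative_sq_sub_one_pow_succ,
    iterate_derivative_natCast_mul', ← mul_assoc (C _), rodrigues_coeff_succ,
    iterate_derivative_X_mul']
  rcases n with _ | k
  · simp
  · have := sq_sub_one_mul_iterate_derivative k
    simp only [Nat.add_sub_cancel]
    push_cast
    linear_combination (C ((2 ^ (k + 1) * ((k + 1).factorial : ℝ))⁻¹) : ℝ[X]) * this

theorem sq_sub_one_mul_derivative_legendre_succ (n : ℕ) :
    ((X : ℝ[X]) ^ 2 - 1) * derivative (legendre (n + 1))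
      = (n + 1 : ℝ[X]) * (X * legendre (n + 1) - legendre n) := by
  linear_combination (X ^ 2 - 1 : ℝ[X]) * derivative_legendre_succ n
    + X * sq_sub_one_mul_derivative_legendre n

/-- Bonnet's three term recurrence. -/
theorem legendre_add_two (n : ℕ) :
    (n + 2 : ℝ[X]) * legendre (n + 2)
      = (2 * n + 3 : ℝ[X]) * X * legendre (n + 1) - (n + 1 : ℝ[X]) * legendre n := by
  have h := sq_sub_one_mul_derivative_legendre (n + 1)
  push_cast at h
  linear_combination sq_sub_one_mul_derivative_legendre_succ n - h

theorem X_mul_derivative_legendre_succ (n : ℕ) :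
    X * derivative (legendre (n + 1)) = derivative (legendre n) + (n + 1 : ℝ[X]) * legendre (n + 1) := by
  linear_combination X * derivative_legendre_succ n + sq_sub_one_mul_derivative_legendre n

theorem derivative_legendre_add_two (n : ℕ) :
    derivative (legendre (n + 2)) = derivative (legendre n) + (2 * n + 3 : ℝ[X]) * legendre (n + 1) := by
  have h := derivative_legendre_succ (n + 1)
  push_cast at h
  linear_combination h + X_mul_derivative_legendre_succ n

/-- Legendre's differential equation. -/
theorem derivative_sq_sub_one_mul_derivative_legendre (n : ℕ) :
    derivative (((X : ℝ[X]) ^ 2 - 1) * derivative (legendre n)) = (n : ℝ[X]) * (n + 1 : ℝ[X]) * legendre n := by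
  rw [sq_sub_one_mul_derivative_legendre]
  have : derivative ((n : ℝ[X]) + 1) = 0 := by simp
  rw [derivative_mul, this]
  simp only [derivative_sub, derivative_mul, derivative_X]
  linear_combination (n + 1 : ℝ[X]) * derivative_legendre_succ n

theorem eval_one_legendre (n : ℕ) : (legendre n).eval 1 = 1 := by
  induction n with
  | zero => simp [legendre_zero]
  | succ n ih =>
    have h := congrArg (eval 1) (sq_sub_one_mul_derivative_legendre n)
    simp [ih] at h
    rcases h with h | h
    · exact absurd h (by positivity)
    · linarith

theorem eval_neg_one_legendre (n : ℕ) : (legendre n).eval (-1) = (-1) ^ n := by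
  induction n with
  | zero => simp [legendre_zero]
  | succ n ih =>
    have h := congrArg (eval (-1)) (sq_sub_one_mul_derivative_legendre n)
    simp [ih] at h
    rcases h with h | h
    · exact absurd h (by positivity)
    · rw [pow_succ]; linarith

/-- The `m`-th derivative of `P_n` at `x`. -/
def legendreDeriv (n m : ℕ) (x : ℝ) : ℝ := (derivative^[m] (legendre n)).eval x

theorem natCast_mul_iterate_derivative_pred (m : ℕ) (p : ℝ[X]) :
    (m : ℝ[X]) * derivative^[m - 1] (derivative p) = m * derivative^[m] p := by
  rcases m with _ | m
  · simp
  · simp [Function.iterate_succ_apply]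

theorem legendreDeriv_succ_succ (n m : ℕ) (x : ℝ) :
    legendreDeriv (n + 1) (m + 1) x
      = x * legendreDeriv n (m + 1) x + (n + m + 1) * legendreDeriv n m x := by
  have e := derivative_legendre_succ n
  rw [show ((n : ℝ[X]) + 1) = ((n + 1 : ℕ) : ℝ[X]) by push_cast; rfl] at e
  have h := congrArg (fun p => eval x (derivative^[m] p)) e
  simp only [iterate_map_add, iterate_derivative_X_mul', iterate_derivative_natCast_mul',
    natCast_mul_iterate_derivative_pred] at h
  simp only [legendreDeriv, Function.iterate_succ_apply]
  simp at h
  linear_combination h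

theorem mul_legendreDeriv_succ_succ (n m : ℕ) (x : ℝ) :
    x * legendreDeriv (n + 1) (m + 1) x
      = legendreDeriv n (m + 1) x + (n + 1 - m) * legendreDeriv (n + 1) m x := by
  have e := X_mul_derivative_legendre_succ n
  rw [show ((n : ℝ[X]) + 1) = ((n + 1 : ℕ) : ℝ[X]) by push_cast; rfl] at e
  have h := congrArg (fun p => eval x (derivative^[m] p)) e
  simp only [iterate_map_add, iterate_derivative_X_mul', iterate_derivative_natCast_mul',
    natCast_mul_iterate_derivative_pred] at h
  simp only [legendreDeriv, Function.iterate_succ_apply]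
  simp at h
  linear_combination h

/-- This and the next two relations express degree n + 1 through degrees n + 2 and n. Used for
orders k, k + 1 and k + 2 of degree n + 1, they all involve the single order k + 1 on the right,
which is what closes the recurrence for `additionCoeff`. -/
theorem legendreDeriv_add_two_sub (n m : ℕ) (x : ℝ) :
    (2 * n + 3) * legendreDeriv (n + 1) m x
      = legendreDeriv (n + 2) (m + 1) x - legendreDeriv n (m + 1) x := by
  have h := legendreDeriv_succ_succ (n + 1) m x
  push_cast at h
  linear_combination -h - mul_legendreDeriv_succ_succ n m x

theorem legendreDeriv_three_term (n m : ℕ) (x : ℝ) :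
    (2 * n + 3) * x * legendreDeriv (n + 1) m x
      = (n + 2 - m) * legendreDeriv (n + 2) m x + (n + 1 + m) * legendreDeriv n m x := by
  rcases m with _ | k
  · have h := congrArg (eval x) (legendre_add_two n)
    simp [legendreDeriv] at h ⊢
    linear_combination -h
  · have h := legendreDeriv_succ_succ (n + 1) k x
    have h2 := mul_legendreDeriv_succ_succ n k x
    push_cast at h ⊢
    linear_combination -(n + 1 - k : ℝ) * h + (n + k + 2 : ℝ) * h2

theorem one_sub_sq_mul_legendreDeriv (n m : ℕ) (x : ℝ) :
    (2 * n + 3) * (1 - x ^ 2) * legendreDeriv (n + 1) (m + 1) x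
      = (n + 1 + m) * (n + 2 + m) * legendreDeriv n m x
        - (n + 1 - m) * (n + 2 - m) * legendreDeriv (n + 2) m x := by
  linear_combination (2 * n + 3 : ℝ) * (legendreDeriv_succ_succ n m x
    - x * mul_legendreDeriv_succ_succ n m x) - (n + 1 - m : ℝ) * legendreDeriv_three_term n m x

theorem natDegree_legendre_le (n : ℕ) : (legendre n).natDegree ≤ n := by
  refine (natDegree_C_mul_le _ _).trans ((natDegree_iterate_derivative _ _).trans ?_)
  have h1 : ((X : ℝ[X]) ^ 2 - 1).natDegree ≤ 2 := by compute_degree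
  have h2 : (((X : ℝ[X]) ^ 2 - 1) ^ n).natDegree ≤ n * 2 := natDegree_pow_le_of_le n h1
  omega

theorem legendreDeriv_eq_zero {n m : ℕ} (h : n < m) (x : ℝ) : legendreDeriv n m x = 0 := by
  rw [legendreDeriv, iterate_derivative_eq_zero ((natDegree_legendre_le n).trans_lt h), eval_zero]

end LegendreAlgebra

/-! ### The bound |P_n| ≤ 1 on [-1, 1], and the bounded, compactly supported kernel. -/

section LegendreBound

/-- By Legendre's equation the energy has a derivative with the sign of X: it is largest on [-1, 1]
at the endpoints, where it equals n(n + 1). -/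
theorem derivative_legendre_energy (n : ℕ) :
    derivative ((n * (n + 1) : ℝ[X]) * legendre n ^ 2
        + (1 - X ^ 2) * derivative (legendre n) ^ 2)
      = (2 * X : ℝ[X]) * derivative (legendre n) ^ 2 := by
  have h := derivative_sq_sub_one_mul_derivative_legendre n
  simp only [pow_two, derivative_add, derivative_mul, derivative_sub, derivative_X,
    derivative_one, derivative_natCast] at h ⊢
  linear_combination (-2 * derivative (legendre n)) * h

theorem abs_eval_legendre_le_one (n : ℕ) {x : ℝ} (hx : x ∈ Set.Icc (-1 : ℝ) 1) :
    |(legendre n).eval x| ≤ 1 := by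
  -- The energy controls n(n + 1)P_n², which says nothing about P_0.
  rcases Nat.eq_zero_or_pos n with rfl | hn
  · simp [legendre_zero]
  set F : ℝ[X] := (n * (n + 1) : ℝ[X]) * legendre n ^ 2
        + (1 - X ^ 2) * derivative (legendre n) ^ 2 with hF
  have hFe (y : ℝ) : F.eval y = n * (n + 1) * (legendre n).eval y ^ 2
      + (1 - y ^ 2) * (derivative (legendre n)).eval y ^ 2 := by simp [hF]
  have hd (y : ℝ) : deriv (fun z => F.eval z) y = 2 * y * (derivative (legendre n)).eval y ^ 2 := by
    rw [Polynomial.deriv, hF, derivative_legendre_energy]; simp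
  have h1 : F.eval 1 = n * (n + 1) := by rw [hFe, eval_one_legendre]; ring
  have h2 : F.eval (-1) = n * (n + 1) := by
    rw [hFe, eval_neg_one_legendre, ← pow_mul, mul_comm n 2, pow_mul]; simp
  have hN : (0 : ℝ) < n * (n + 1) := by positivity
  have hle : F.eval x ≤ n * (n + 1) := by
    rcases le_total 0 x with h | h
    · rw [← h1]
      refine monotoneOn_of_deriv_nonneg (convex_Icc (0 : ℝ) 1) F.continuous.continuousOn
        F.differentiable.differentiableOn (fun y hy => ?_) ⟨h, hx.2⟩ ⟨zero_le_one, le_rfl⟩ hx.2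
      rw [interior_Icc] at hy
      rw [hd]
      have := hy.1.le
      positivity
    · rw [← h2]
      refine antitoneOn_of_deriv_nonpos (convex_Icc (-1 : ℝ) 0) F.continuous.continuousOn
        F.differentiable.differentiableOn (fun y hy => ?_) ⟨le_rfl, by norm_num⟩ ⟨hx.1, h⟩ hx.1
      rw [interior_Icc] at hy
      rw [hd]
      exact mul_nonpos_of_nonpos_of_nonneg (by linarith [hy.2]) (sq_nonneg _)
  rw [hFe] at hle
  have h3 : 0 ≤ (1 - x ^ 2) * (derivative (legendre n)).eval x ^ 2 :=
    mul_nonneg (by nlinarith [hx.1, hx.2]) (sq_nonneg _)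
  rw [abs_le_one_iff_mul_self_le_one]
  by_contra! hcon
  nlinarith

theorem argument_mem_Icc {c r r' t : ℝ} (hc : 0 < c) (hr : 0 < r) (hr' : 0 < r')
    (ht : t ∈ Set.Icc (|r - r'| / c) ((r + r') / c)) :
    (r ^ 2 + r' ^ 2 - c ^ 2 * t ^ 2) / (2 * r * r') ∈ Set.Icc (-1 : ℝ) 1 := by
  obtain ⟨h1, h2⟩ := ht
  rw [div_le_iff₀ hc] at h1
  rw [le_div_iff₀ hc] at h2
  have h3 : (r - r') ^ 2 ≤ (t * c) ^ 2 := by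
    rw [← sq_abs (r - r')]; exact pow_le_pow_left₀ (abs_nonneg _) h1 2
  have h4 : (t * c) ^ 2 ≤ (r + r') ^ 2 := pow_le_pow_left₀ ((abs_nonneg _).trans h1) h2 2
  have hp : 0 < 2 * r * r' := by positivity
  constructor
  · rw [le_div_iff₀ hp]; nlinarith
  · rw [div_le_iff₀ hp]; nlinarith

theorem abs_kernelZero_le {c r r' : ℝ} (hc : 0 < c) (hr : 0 < r) (hr' : 0 < r') (n : ℕ) (t : ℝ) :
    |kernelZero c r r' n t| ≤ c / (2 * r * r') := by
  have hp : 0 < c / (2 * r * r') := by positivity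
  rw [kernelZero, abs_mul, abs_of_pos hp]
  refine mul_le_of_le_one_right hp.le ?_
  by_cases ht : t ∈ Set.Icc (|r - r'| / c) ((r + r') / c)
  · simpa [legendrePulse, pulse, Set.indicator_of_mem ht] using
      abs_eval_legendre_le_one n (argument_mem_Icc hc hr hr' ht)
  · simp [legendrePulse, pulse, Set.indicator_of_notMem ht]

theorem hasCompactSupport_kernelZero (c r r' : ℝ) (n : ℕ) :
    HasCompactSupport (kernelZero c r r' n) := by
  refine HasCompactSupport.intro (isCompact_Icc (a := |r - r'| / c) (b := (r + r') / c)) ?_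
  intro t ht
  simp [kernelZero, legendrePulse, pulse, Set.indicator_of_notMem ht]

end LegendreBound

/-! ### Orthogonality, norms and completeness of the Legendre polynomials. -/

section LegendreOrthogonality

/-- Bonnet's recurrence shifted so as to include n = 0, where the truncated `n - 1` carries the
coefficient 0. -/
theorem legendre_succ (n : ℕ) :
    ((n + 1 : ℝ) • legendre (n + 1) : ℝ[X])
      = (2 * n + 1 : ℝ) • (X * legendre n) - (n : ℝ) • legendre (n - 1) := by
  rcases n with _ | n
  · simp [legendre_one, legendre_zero]
  · have h := legendre_add_two n
    simp only [smul_eq_C_mul, Nat.add_sub_cancel]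
    push_cast
    simp only [map_add, map_mul, map_one, map_natCast, C_ofNat]
    linear_combination h

/-- Bonnet's recurrence solved for X P_n. Since P_0 = 1, stability under multiplication by X puts
every power of X in the span. -/
theorem X_mul_mem_span_legendre {p : ℝ[X]} (hp : p ∈ Submodule.span ℝ (Set.range legendre)) :
    X * p ∈ Submodule.span ℝ (Set.range legendre) := by
  induction hp using Submodule.span_induction with
  | mem p h =>
    obtain ⟨n, rfl⟩ := h
    have h0 : (2 * n + 1 : ℝ) ≠ 0 := by positivity
    have h1 : X * legendre n = (2 * n + 1 : ℝ)⁻¹ • ((n + 1 : ℝ) • legendre (n + 1)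
        + (n : ℝ) • legendre (n - 1)) := by
      rw [legendre_succ, sub_add_cancel, smul_smul, inv_mul_cancel₀ h0, one_smul]
    rw [h1]
    exact Submodule.smul_mem _ _ (Submodule.add_mem _
      (Submodule.smul_mem _ _ (Submodule.subset_span ⟨_, rfl⟩))
      (Submodule.smul_mem _ _ (Submodule.subset_span ⟨_, rfl⟩)))
  | zero => simp
  | add p q _ _ hp hq => rw [mul_add]; exact Submodule.add_mem _ hp hq
  | smul a p _ hp => rw [mul_smul_comm]; exact Submodule.smul_mem _ _ hp

theorem span_legendre : Submodule.span ℝ (Set.range legendre) = ⊤ := by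
  have hX (k : ℕ) : (X : ℝ[X]) ^ k ∈ Submodule.span ℝ (Set.range legendre) := by
    induction k with
    | zero => exact Submodule.subset_span ⟨0, by simp [legendre_zero]⟩
    | succ k ih => rw [pow_succ']; exact X_mul_mem_span_legendre ih
  rw [eq_top_iff]
  intro p _
  rw [p.as_sum_range_C_mul_X_pow]
  refine Submodule.sum_mem _ fun i _ => ?_
  rw [← smul_eq_C_mul]
  exact Submodule.smul_mem _ _ (hX i)

/-- Integration of a polynomial against a continuous function over `[-1, 1]`. -/
def integralPolynomialMul (h : ℝ → ℝ) (hh : ContinuousOn h (Set.Icc (-1) 1)) : ℝ[X] →ₗ[ℝ] ℝ where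
  toFun p := ∫ x in (-1 : ℝ)..1, p.eval x * h x
  map_add' p q := by
    have hi (p : ℝ[X]) : IntervalIntegrable (fun x => p.eval x * h x) volume (-1) 1 := by
      refine ContinuousOn.intervalIntegrable ?_
      rw [Set.uIcc_of_le (by norm_num)]
      exact p.continuous.continuousOn.mul hh
    rw [← intervalIntegral.integral_add (hi p) (hi q)]
    simp [add_mul]
  map_smul' a p := by
    simp [mul_assoc]

/-- F is (X² - 1) times the Wronskian: it vanishes at ±1, and its derivative is P_m P_n times the
difference of eigenvalues (m - n)(m + n + 1). -/
theorem integral_legendre_mul_legendre_of_ne {m n : ℕ} (hmn : m ≠ n) :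
    ∫ x in (-1 : ℝ)..1, (legendre m).eval x * (legendre n).eval x = 0 := by
  set F : ℝ[X] := (X ^ 2 - 1) * derivative (legendre m) * legendre n
    - (X ^ 2 - 1) * derivative (legendre n) * legendre m with hF
  have hF' : derivative F = C (m * (m + 1) - n * (n + 1) : ℝ) * (legendre m * legendre n) := by
    rw [hF, derivative_sub, derivative_mul, derivative_mul (f := (X ^ 2 - 1) * _),
      derivative_sq_sub_one_mul_derivative_legendre,
      derivative_sq_sub_one_mul_derivative_legendre]
    simp only [map_sub, map_mul, map_add, map_natCast, map_one]
    ring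
  have h1 : ∫ x in (-1 : ℝ)..1, (derivative F).eval x = 0 := by
    rw [intervalIntegral.integral_eq_sub_of_hasDerivAt (fun x _ => F.hasDerivAt x)
      ((derivative F).continuous.intervalIntegrable _ _)]
    simp [hF]
  rw [hF'] at h1
  simp only [eval_mul, eval_C, intervalIntegral.integral_const_mul] at h1
  refine (mul_eq_zero.1 h1).resolve_left fun h => hmn ?_
  have h3 : ((m : ℝ) - n) * (m + n + 1) = 0 := by linear_combination h
  have h4 : (m : ℝ) + n + 1 ≠ 0 := by positivity
  exact_mod_cast sub_eq_zero.1 ((mul_eq_zero.1 h3).resolve_right h4)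

/-- Let A = ∫ X P_n P_{n+1} and N_n = ∫ P_n². Pairing two consecutive recurrences with P_{n+1} and
P_n gives (n + 1)N_{n+1} = (2n + 1)A and (2n + 3)A = (n + 1)N_n. -/
theorem integral_legendre_sq (n : ℕ) :
    ∫ x in (-1 : ℝ)..1, (legendre n).eval x * (legendre n).eval x = 2 / (2 * n + 1) := by
  induction n with
  | zero => simp [legendre_zero]; norm_num
  | succ n ih =>
    have hI (k : ℕ) (p : ℝ[X]) : integralPolynomialMul (fun x => (legendre k).eval x)
        (legendre k).continuous.continuousOn p
        = ∫ x in (-1 : ℝ)..1, p.eval x * (legendre k).eval x := rfl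
    have e1 := congrArg (integralPolynomialMul (fun x => (legendre (n + 1)).eval x)
      (legendre (n + 1)).continuous.continuousOn) (legendre_succ n)
    have e2 := congrArg (integralPolynomialMul (fun x => (legendre n).eval x)
      (legendre n).continuous.continuousOn) (legendre_succ (n + 1))
    simp only [map_sub, map_smul] at e1 e2
    simp only [hI, smul_eq_mul, Nat.add_sub_cancel] at e1 e2
    rw [integral_legendre_mul_legendre_of_ne (m := n - 1) (n := n + 1) (by omega)] at e1
    rw [integral_legendre_mul_legendre_of_ne (m := n + 1 + 1) (n := n) (by omega), ih] at e2
    have e3 : ∫ x in (-1 : ℝ)..1, (X * legendre (n + 1)).eval x * (legendre n).eval x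
        = ∫ x in (-1 : ℝ)..1, (X * legendre n).eval x * (legendre (n + 1)).eval x := by
      congr 1; ext x; simp; ring
    rw [e3] at e2
    push_cast at *
    set A := ∫ x in (-1 : ℝ)..1, (X * legendre n).eval x * (legendre (n + 1)).eval x
    have h1 : (2 * (n : ℝ) + 1) ≠ 0 := by positivity
    have h2 : (2 * ((n : ℝ) + 1) + 1) ≠ 0 := by positivity
    have h3 : ((n : ℝ) + 1) ≠ 0 := by positivity
    have e4 : (2 * ((n : ℝ) + 1) + 1) * A * (2 * n + 1) = (n + 1) * 2 := by
      field_simp at e2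
      linear_combination -e2
    rw [eq_div_iff h2]
    refine mul_left_cancel₀ h3 ?_
    linear_combination (2 * ((n : ℝ) + 1) + 1) * e1 + e4

/-- h is orthogonal to all polynomials, so ∫ h² = ∫ (h - p)h for every polynomial p, and
Weierstrass' theorem makes the right side arbitrarily small. -/
theorem eq_zero_of_integral_legendre_mul_eq_zero {h : ℝ → ℝ}
    (hh : ContinuousOn h (Set.Icc (-1) 1))
    (h0 : ∀ n, ∫ x in (-1 : ℝ)..1, (legendre n).eval x * h x = 0) {x : ℝ}
    (hx : x ∈ Set.Icc (-1 : ℝ) 1) : h x = 0 := by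
  have huIcc : Set.uIcc (-1 : ℝ) 1 = Set.Icc (-1) 1 := Set.uIcc_of_le (by norm_num)
  have hp (p : ℝ[X]) : ∫ x in (-1 : ℝ)..1, p.eval x * h x = 0 := by
    have hle : Submodule.span ℝ (Set.range legendre) ≤ (integralPolynomialMul h hh).ker := by
      rw [Submodule.span_le]
      rintro _ ⟨n, rfl⟩
      exact h0 n
    exact hle (span_legendre ▸ Submodule.mem_top : p ∈ _)
  have hi {f : ℝ → ℝ} (hf : ContinuousOn f (Set.Icc (-1) 1)) :
      IntervalIntegrable f volume (-1) 1 := (huIcc ▸ hf).intervalIntegrable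
  have hsq : ∫ x in (-1 : ℝ)..1, h x * h x ≤ 0 := by
    set M := ∫ x in (-1 : ℝ)..1, |h x|
    have hM : 0 ≤ M := intervalIntegral.integral_nonneg (by norm_num) fun _ _ => abs_nonneg _
    refine le_of_forall_pos_le_add fun ε hε => ?_
    -- The tolerance is divided by M + 1, not M, since M may vanish.
    obtain ⟨p, hpε⟩ := exists_polynomial_near_of_continuousOn (-1) 1 h hh (ε / (M + 1))
      (by positivity)
    have e1 : ∫ x in (-1 : ℝ)..1, h x * h x = ∫ x in (-1 : ℝ)..1, (h x - p.eval x) * h x := by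
      have e2 := intervalIntegral.integral_sub (hi (hh.mul hh))
        (hi (p.continuous.continuousOn.mul hh))
      simp only [Pi.mul_apply, hp, sub_zero] at e2
      simp only [sub_mul, e2]
    rw [e1, zero_add]
    calc ∫ x in (-1 : ℝ)..1, (h x - p.eval x) * h x
        ≤ ∫ x in (-1 : ℝ)..1, ε / (M + 1) * |h x| := by
          refine intervalIntegral.integral_mono_on (by norm_num)
            (hi ((hh.sub p.continuous.continuousOn).mul hh)) (hi (continuousOn_const.mul hh.abs))
            fun y hy => (le_abs_self _).trans ?_
          rw [abs_mul, abs_sub_comm]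
          exact mul_le_mul_of_nonneg_right (hpε y hy).le (abs_nonneg _)
      _ = ε / (M + 1) * M := intervalIntegral.integral_const_mul _ _
      _ ≤ ε := by
          rw [div_mul_eq_mul_div, div_le_iff₀ (by positivity)]
          nlinarith
  by_contra hne
  refine absurd hsq (not_le.2 ?_)
  exact intervalIntegral.integral_pos (by norm_num) (hh.mul hh) (fun y _ => mul_self_nonneg _)
    ⟨x, hx, mul_self_pos.2 hne⟩

theorem eq_zero_of_integral_legendre_mul_eq_zero_complex {h : ℝ → ℂ}
    (hh : ContinuousOn h (Set.Icc (-1) 1))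
    (h0 : ∀ n, ∫ x in (-1 : ℝ)..1, (((legendre n).eval x : ℝ) : ℂ) * h x = 0) {x : ℝ}
    (hx : x ∈ Set.Icc (-1 : ℝ) 1) : h x = 0 := by
  have hi (n : ℕ) : IntervalIntegrable (fun x => (((legendre n).eval x : ℝ) : ℂ) * h x)
      volume (-1) 1 := by
    refine ContinuousOn.intervalIntegrable ?_
    rw [Set.uIcc_of_le (by norm_num)]
    exact (Complex.continuous_ofReal.comp (legendre n).continuous).continuousOn.mul hh
  refine Complex.ext ?_ ?_
  · refine eq_zero_of_integral_legendre_mul_eq_zero (h := fun x => (h x).re)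
      (Complex.continuous_re.comp_continuousOn hh) (fun n => ?_) hx
    have := Complex.reCLM.intervalIntegral_comp_comm (hi n)
    simpa [h0] using this
  · refine eq_zero_of_integral_legendre_mul_eq_zero (h := fun x => (h x).im)
      (Complex.continuous_im.comp_continuousOn hh) (fun n => ?_) hx
    have := Complex.imCLM.intervalIntegral_comp_comm (hi n)
    simpa [h0] using this

end LegendreOrthogonality

/-! ### Convergence of the Legendre series of a smooth function. -/

section LegendreExpansion

open scoped ContDiff

/-- The integral of `g` against the Legendre polynomial `P_n` over `[-1, 1]`. -/
def legendreCoeff (g : ℝ → ℂ) (n : ℕ) : ℂ :=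
  ∫ y in (-1 : ℝ)..1, (((legendre n).eval y : ℝ) : ℂ) * g y

/-- Legendre's differential operator `g ↦ ((y² - 1) g')'`. -/
def legendreOp (g : ℝ → ℂ) : ℝ → ℂ := deriv fun z => ((z ^ 2 - 1 : ℝ) : ℂ) * deriv g z

theorem uIcc_neg_one_one : Set.uIcc (-1 : ℝ) 1 = Set.Icc (-1) 1 := Set.uIcc_of_le (by norm_num)

theorem continuous_ofReal_eval (p : ℝ[X]) : Continuous fun y : ℝ => ((p.eval y : ℝ) : ℂ) :=
  Complex.continuous_ofReal.comp p.continuous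

theorem contDiffOn_sq_sub_one_mul_deriv {U : Set ℝ} (hU : IsOpen U) {g : ℝ → ℂ}
    (hg : ContDiffOn ℝ ∞ g U) :
    ContDiffOn ℝ ∞ (fun z => ((z ^ 2 - 1 : ℝ) : ℂ) * deriv g z) U := by
  refine ContDiffOn.mul ?_ (hg.deriv_of_isOpen hU (by simp))
  exact (Complex.ofRealCLM.contDiff.comp (by fun_prop : ContDiff ℝ ∞ fun z : ℝ => z ^ 2 - 1)).contDiffOn

theorem contDiffOn_legendreOp {U : Set ℝ} (hU : IsOpen U) {g : ℝ → ℂ}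
    (hg : ContDiffOn ℝ ∞ g U) : ContDiffOn ℝ ∞ (legendreOp g) U :=
  (contDiffOn_sq_sub_one_mul_deriv hU hg).deriv_of_isOpen hU (by simp)

/-- Green's identity: the factor y² - 1 removes the boundary terms, so the operator moves onto P_n,
an eigenfunction with eigenvalue n(n + 1). -/
theorem legendreCoeff_legendreOp {U : Set ℝ} (hU : IsOpen U) (hIU : Set.Icc (-1) 1 ⊆ U)
    {g : ℝ → ℂ} (hg : ContDiffOn ℝ ∞ g U) (n : ℕ) :
    legendreCoeff (legendreOp g) n = (n * (n + 1)) * legendreCoeff g n := by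
  set q : ℝ[X] := (X ^ 2 - 1) * derivative (legendre n) with hq
  have hq' : derivative q = (n : ℝ[X]) * (n + 1 : ℝ[X]) * legendre n :=
    derivative_sq_sub_one_mul_derivative_legendre n
  have hder (y : ℝ) (hy : y ∈ Set.uIcc (-1 : ℝ) 1) :
      HasDerivAt (fun y => (((legendre n).eval y : ℝ) : ℂ) * (((y ^ 2 - 1 : ℝ) : ℂ) * deriv g y)
          - ((q.eval y : ℝ) : ℂ) * g y)
        ((((legendre n).eval y : ℝ) : ℂ) * legendreOp g y
          - (n * (n + 1)) * ((((legendre n).eval y : ℝ) : ℂ) * g y)) y := by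
    have hyU : U ∈ nhds y := hU.mem_nhds (hIU (uIcc_neg_one_one ▸ hy))
    have h1 : HasDerivAt g (deriv g y) y :=
      ((hg.contDiffAt hyU).differentiableAt (by simp)).hasDerivAt
    have h2 : HasDerivAt (fun z => ((z ^ 2 - 1 : ℝ) : ℂ) * deriv g z) (legendreOp g y) y :=
      (((contDiffOn_sq_sub_one_mul_deriv hU hg).contDiffAt hyU).differentiableAt
        (by simp)).hasDerivAt
    have h3 := ((legendre n).hasDerivAt y).ofReal_comp
    have h4 := (q.hasDerivAt y).ofReal_comp
    refine ((h3.mul h2).sub (h4.mul h1)).congr_deriv ?_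
    rw [hq', hq]
    simp
    ring
  have hcont : ContinuousOn (fun y => (((legendre n).eval y : ℝ) : ℂ) * legendreOp g y)
      (Set.uIcc (-1 : ℝ) 1) :=
    (continuous_ofReal_eval _).continuousOn.mul
      ((contDiffOn_legendreOp hU hg).continuousOn.mono (uIcc_neg_one_one ▸ hIU))
  have hcont2 : ContinuousOn (fun y => (((legendre n).eval y : ℝ) : ℂ) * g y)
      (Set.uIcc (-1 : ℝ) 1) :=
    (continuous_ofReal_eval _).continuousOn.mul
      (hg.continuousOn.mono (uIcc_neg_one_one ▸ hIU))
  have h := intervalIntegral.integral_eq_sub_of_hasDerivAt hder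
    (hcont.intervalIntegrable.sub (hcont2.intervalIntegrable.const_mul _))
  rw [intervalIntegral.integral_sub hcont.intervalIntegrable
    (hcont2.intervalIntegrable.const_mul _), intervalIntegral.integral_const_mul] at h
  simp [hq] at h
  exact sub_eq_zero.1 h

theorem exists_norm_legendreCoeff_le {g : ℝ → ℂ} (hg : ContinuousOn g (Set.Icc (-1) 1)) :
    ∃ M : ℝ, ∀ n, ‖legendreCoeff g n‖ ≤ M := by
  obtain ⟨M, hM⟩ := isCompact_Icc.exists_bound_of_continuousOn hg
  refine ⟨M * |1 - (-1)|, fun n => intervalIntegral.norm_integral_le_of_norm_le_const ?_⟩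
  intro y hy
  rw [Set.uIoc_of_le (by norm_num)] at hy
  have hy' : y ∈ Set.Icc (-1 : ℝ) 1 := ⟨hy.1.le, hy.2⟩
  rw [norm_mul, Complex.norm_real, Real.norm_eq_abs]
  exact (mul_le_of_le_one_left (norm_nonneg _) (abs_eval_legendre_le_one n hy')).trans (hM y hy')

/-- Two applications of the operator are needed: one leaves weighted coefficients of order 1/n,
while two give more than the bound 1/n² used here. -/
theorem summable_norm_legendreCoeff {U : Set ℝ} (hU : IsOpen U) (hIU : Set.Icc (-1) 1 ⊆ U)
    {g : ℝ → ℂ} (hg : ContDiffOn ℝ ∞ g U) :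
    Summable fun n : ℕ => (2 * n + 1) / 2 * ‖legendreCoeff g n‖ := by
  have hg1 := contDiffOn_legendreOp hU hg
  have hg2 := contDiffOn_legendreOp hU hg1
  obtain ⟨M, hM⟩ := exists_norm_legendreCoeff_le (hg2.continuousOn.mono hIU)
  have hM0 : 0 ≤ M := (norm_nonneg _).trans (hM 0)
  -- Degree 0 is dropped because its eigenvalue is zero.
  rw [← summable_nat_add_iff 1]
  refine Summable.of_nonneg_of_le (fun n => by positivity) (fun n => ?_)
    (((summable_nat_add_iff 1).2 (Real.summable_nat_pow_inv (p := 2).2 (by norm_num))).mul_left M)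
  have h := hM (n + 1)
  rw [legendreCoeff_legendreOp hU hIU hg1, legendreCoeff_legendreOp hU hIU hg, norm_mul,
    norm_mul (_ * _) (legendreCoeff _ _)] at h
  have e : ‖(((n + 1 : ℕ) : ℂ) * (((n + 1 : ℕ) : ℂ) + 1))‖ = ((n : ℝ) + 1) * (n + 2) := by
    have : (((n + 1 : ℕ) : ℂ) * (((n + 1 : ℕ) : ℂ) + 1))
        = ((((n : ℝ) + 1) * (n + 2) : ℝ) : ℂ) := by
      push_cast; ring
    rw [this, Complex.norm_real, Real.norm_of_nonneg (by positivity)]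
  rw [e] at h
  set a := ‖legendreCoeff g (n + 1)‖
  have ha : 0 ≤ a := norm_nonneg _
  have hn : (0 : ℝ) ≤ n := n.cast_nonneg
  push_cast
  rw [← div_eq_mul_inv, le_div_iff₀ (by positivity)]
  refine le_trans ?_ h
  have key : (2 * ((n : ℝ) + 1) + 1) / 2 * (n + 1) ^ 2 ≤ (n + 1) * (n + 2) * ((n + 1) * (n + 2)) := by
    nlinarith [mul_nonneg hn hn, mul_nonneg hn (mul_nonneg hn hn),
      mul_nonneg (mul_nonneg hn hn) (mul_nonneg hn hn)]
  calc (2 * ((n : ℝ) + 1) + 1) / 2 * a * (n + 1) ^ 2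
      = (2 * ((n : ℝ) + 1) + 1) / 2 * (n + 1) ^ 2 * a := by ring
    _ ≤ (n + 1) * (n + 2) * ((n + 1) * (n + 2)) * a := mul_le_mul_of_nonneg_right key ha
    _ = _ := by ring

/-- A smooth function on a neighbourhood of `[-1, 1]` is the sum of its Legendre series. -/
theorem hasSum_legendre {U : Set ℝ} (hU : IsOpen U) (hIU : Set.Icc (-1) 1 ⊆ U)
    {g : ℝ → ℂ} (hg : ContDiffOn ℝ ∞ g U) {x : ℝ} (hx : x ∈ Set.Icc (-1 : ℝ) 1) :
    HasSum (fun n : ℕ => (((2 * n + 1) / 2 * (legendre n).eval x : ℝ) : ℂ) * legendreCoeff g n)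
      (g x) := by
  set u : ℕ → ℝ := fun n => (2 * n + 1) / 2 * ‖legendreCoeff g n‖ with hu
  have hus : Summable u := summable_norm_legendreCoeff hU hIU hg
  set F : ℕ → ℝ → ℂ := fun n y =>
    (((2 * n + 1) / 2 * (legendre n).eval y : ℝ) : ℂ) * legendreCoeff g n with hF
  have hFu (n : ℕ) (y : ℝ) (hy : y ∈ Set.Icc (-1 : ℝ) 1) : ‖F n y‖ ≤ u n := by
    rw [hF, hu]
    simp only [norm_mul, Complex.norm_real, Real.norm_eq_abs]
    rw [abs_of_nonneg (by positivity : (0 : ℝ) ≤ (2 * n + 1) / 2)]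
    gcongr
    exact mul_le_of_le_one_right (by positivity) (abs_eval_legendre_le_one n hy)
  have hFc (n : ℕ) : Continuous (F n) := by
    refine Continuous.mul (Complex.continuous_ofReal.comp ?_) continuous_const
    exact continuous_const.mul (legendre n).continuous
  have hFs (y : ℝ) (hy : y ∈ Set.Icc (-1 : ℝ) 1) : Summable fun n => F n y :=
    Summable.of_norm_bounded hus fun n => hFu n y hy
  have hSc : ContinuousOn (fun y => ∑' n, F n y) (Set.Icc (-1) 1) :=
    continuousOn_tsum (fun n => (hFc n).continuousOn) hus hFu
  have hgc : ContinuousOn g (Set.Icc (-1) 1) := hg.continuousOn.mono hIU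
  -- The sum of the series is continuous; integrated term by term against P_k it has the same
  -- coefficient as g, so completeness forces equality.
  have hzero : (fun y => (∑' n, F n y) - g y) x = 0 := by
    refine eq_zero_of_integral_legendre_mul_eq_zero_complex (hSc.sub hgc) (fun k => ?_) hx
    have hPc := continuous_ofReal_eval (legendre k)
    have hi1 : IntervalIntegrable (fun y => (((legendre k).eval y : ℝ) : ℂ) * ∑' n, F n y)
        volume (-1) 1 := (uIcc_neg_one_one ▸ hPc.continuousOn.mul hSc).intervalIntegrable
    have hi2 : IntervalIntegrable (fun y => (((legendre k).eval y : ℝ) : ℂ) * g y)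
        volume (-1) 1 := (uIcc_neg_one_one ▸ hPc.continuousOn.mul hgc).intervalIntegrable
    change ∫ y in (-1 : ℝ)..1, (((legendre k).eval y : ℝ) : ℂ) * ((∑' n, F n y) - g y) = 0
    simp only [mul_sub]
    rw [intervalIntegral.integral_sub hi1 hi2, sub_eq_zero]
    have hsum : HasSum (fun n => ∫ y in (-1 : ℝ)..1, (((legendre k).eval y : ℝ) : ℂ) * F n y)
        (∫ y in (-1 : ℝ)..1, (((legendre k).eval y : ℝ) : ℂ) * ∑' n, F n y) := by
      refine intervalIntegral.hasSum_integral_of_dominated_convergence (fun n _ => u n)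
        (fun n => (hPc.mul (hFc n)).aestronglyMeasurable) (fun n => ?_) (by simp [hus])
        intervalIntegrable_const ?_
      · refine Filter.Eventually.of_forall fun y hy => ?_
        rw [Set.uIoc_of_le (by norm_num)] at hy
        have hy' : y ∈ Set.Icc (-1 : ℝ) 1 := ⟨hy.1.le, hy.2⟩
        rw [norm_mul, Complex.norm_real, Real.norm_eq_abs]
        exact (mul_le_of_le_one_left (norm_nonneg _) (abs_eval_legendre_le_one k hy')).trans
          (hFu n y hy')
      · refine Filter.Eventually.of_forall fun y hy => ?_
        rw [Set.uIoc_of_le (by norm_num)] at hy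
        exact (hFs y ⟨hy.1.le, hy.2⟩).hasSum.mul_left _
    have hterm (n : ℕ) : ∫ y in (-1 : ℝ)..1, (((legendre k).eval y : ℝ) : ℂ) * F n y
        = if n = k then legendreCoeff g k else 0 := by
      have e : (fun y => (((legendre k).eval y : ℝ) : ℂ) * F n y) = fun y =>
          (((2 * n + 1) / 2 : ℝ) * legendreCoeff g n)
            * (((legendre k).eval y * (legendre n).eval y : ℝ) : ℂ) := by
        ext y; simp only [hF]; push_cast; ring
      rw [e, intervalIntegral.integral_const_mul, intervalIntegral.integral_ofReal]
      split_ifs with h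
      · subst h
        rw [integral_legendre_sq]
        have : (2 * (n : ℂ) + 1) ≠ 0 := by exact_mod_cast (by positivity : (2 * (n : ℝ) + 1) ≠ 0)
        push_cast
        field_simp
      · rw [integral_legendre_mul_legendre_of_ne (Ne.symm h)]
        simp
    simp only [hterm] at hsum
    exact hsum.unique (hasSum_ite_eq k _)
  have := (hFs x hx).hasSum
  rwa [sub_eq_zero.1 hzero] at this

end LegendreExpansion

/-! ### The addition theorem for Legendre polynomials and spherical harmonics. -/

section AdditionTheorem

/-- The coefficient of `cos (k ψ)` in the addition theorem, with `(a, s)` and `(b, t)` the cosines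
and sines of the two polar angles. -/
def additionCoeff (a b s t : ℝ) (n k : ℕ) : ℝ :=
  ((n - k).factorial / (n + k).factorial : ℝ) * (s * t) ^ k
    * (legendreDeriv n k a * legendreDeriv n k b)

theorem additionCoeff_eq_zero (a b s t : ℝ) {n k : ℕ} (h : n < k) :
    additionCoeff a b s t n k = 0 := by
  simp [additionCoeff, legendreDeriv_eq_zero h]

/-- At order 0 the neighbours ±1 have equal coefficients, so the half-sum of the general recurrence
becomes a single term. -/
theorem additionCoeff_recurrence_zero {a b s t : ℝ} (hs : s ^ 2 = 1 - a ^ 2) (ht : t ^ 2 = 1 - b ^ 2)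
    (n : ℕ) :
    (n + 2) * additionCoeff a b s t (n + 2) 0
      = (2 * n + 3) * (a * b * additionCoeff a b s t (n + 1) 0
          + s * t * additionCoeff a b s t (n + 1) 1) - (n + 1) * additionCoeff a b s t n 0 := by
  have hc : ((n + 1 - 1).factorial / (n + 1 + 1).factorial : ℝ) = 1 / ((n + 1) * (n + 2)) := by
    have : (n.factorial : ℝ) ≠ 0 := by exact_mod_cast n.factorial_ne_zero
    rw [Nat.add_sub_cancel, Nat.factorial_succ, Nat.factorial_succ]
    push_cast
    field_simp
    ring
  have hd (k : ℕ) : ((k - 0).factorial / (k + 0).factorial : ℝ) = 1 :=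
    div_self (by exact_mod_cast k.factorial_ne_zero)
  simp only [additionCoeff, hc, hd, pow_zero, pow_one]
  have a1 := legendreDeriv_three_term n 0 a
  have b1 := legendreDeriv_three_term n 0 b
  have a2 := one_sub_sq_mul_legendreDeriv n 0 a
  have b2 := one_sub_sq_mul_legendreDeriv n 0 b
  rw [← hs] at a2
  rw [← ht] at b2
  simp only [Nat.cast_zero, sub_zero, add_zero, zero_add] at a1 b1 a2 b2 ⊢
  generalize legendreDeriv (n + 2) 0 a = u at *
  generalize legendreDeriv (n + 2) 0 b = u' at *
  generalize legendreDeriv n 0 a = v at *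
  generalize legendreDeriv n 0 b = v' at *
  generalize legendreDeriv (n + 1) 0 a = p at *
  generalize legendreDeriv (n + 1) 0 b = p' at *
  generalize legendreDeriv (n + 1) 1 a = q at *
  generalize legendreDeriv (n + 1) 1 b = q' at *
  have h1 : (2 * (n : ℝ) + 3) ≠ 0 := by positivity
  have e1 : (2 * (n : ℝ) + 3) * a * p * ((2 * n + 3) * b * p')
    = ((n + 2) * u + (n + 1) * v) * ((n + 2) * u' + (n + 1) * v') := by rw [a1, b1]
  have e2 : (2 * (n : ℝ) + 3) * s ^ 2 * q * ((2 * n + 3) * t ^ 2 * q')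
    = ((n + 1) * (n + 2) * v - (n + 1) * (n + 2) * u)
      * ((n + 1) * (n + 2) * v' - (n + 1) * (n + 2) * u') := by rw [a2, b2]
  refine mul_left_cancel₀ h1 ?_
  have h2 : ((n : ℝ) + 1) * (n + 2) ≠ 0 := by positivity
  refine mul_left_cancel₀ h2 ?_
  have e3 : ((n : ℝ) + 1) * (n + 2) * (1 / ((n + 1) * (n + 2))) = 1 := by field_simp
  linear_combination -((n : ℝ) + 1) * (n + 2) * e1 - e2
    - (2 * n + 3) * (2 * n + 3) * (s * t) * ((s * t) * (q * q')) * e3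

/-- Bonnet's recurrence at ab + st cos ψ, read off on Fourier coefficients: multiplying by cos ψ
averages the two neighbouring orders. Once degree n + 1 is eliminated, an identity between products
of u, v and u', v' with factorial weights remains (`key`). -/
theorem additionCoeff_recurrence_succ {a b s t : ℝ} (hs : s ^ 2 = 1 - a ^ 2)
    (ht : t ^ 2 = 1 - b ^ 2) (n k : ℕ) :
    (n + 2) * additionCoeff a b s t (n + 2) (k + 1)
      = (2 * n + 3) * (a * b * additionCoeff a b s t (n + 1) (k + 1)
          + s * t / 2 * (additionCoeff a b s t (n + 1) k + additionCoeff a b s t (n + 1) (k + 2)))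
        - (n + 1) * additionCoeff a b s t n (k + 1) := by
  simp only [additionCoeff]
  have a1 := legendreDeriv_three_term n (k + 1) a
  have b1 := legendreDeriv_three_term n (k + 1) b
  have a2 := one_sub_sq_mul_legendreDeriv n (k + 1) a
  have b2 := one_sub_sq_mul_legendreDeriv n (k + 1) b
  have a3 := legendreDeriv_add_two_sub n k a
  have b3 := legendreDeriv_add_two_sub n k b
  have hva : n ≤ k → legendreDeriv n (k + 1) a = 0 := fun h => legendreDeriv_eq_zero (by omega) a
  have hvb : n ≤ k → legendreDeriv n (k + 1) b = 0 := fun h => legendreDeriv_eq_zero (by omega) b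
  have hua : n + 2 ≤ k → legendreDeriv (n + 2) (k + 1) a = 0 :=
    fun h => legendreDeriv_eq_zero (by omega) a
  rw [← hs] at a2
  rw [← ht] at b2
  generalize legendreDeriv (n + 2) (k + 1) a = u at *
  generalize legendreDeriv (n + 2) (k + 1) b = u' at *
  generalize legendreDeriv n (k + 1) a = v at *
  generalize legendreDeriv n (k + 1) b = v' at *
  generalize legendreDeriv (n + 1) (k + 1) a = p at *
  generalize legendreDeriv (n + 1) (k + 1) b = p' at *
  simp only [show k + 1 + 1 = k + 2 from rfl] at a2 b2
  generalize legendreDeriv (n + 1) (k + 2) a = q at *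
  generalize legendreDeriv (n + 1) (k + 2) b = q' at *
  generalize legendreDeriv (n + 1) k a = l at *
  generalize legendreDeriv (n + 1) k b = l' at *
  have e1 := congrArg₂ (· * ·) a1 b1
  have e2 := congrArg₂ (· * ·) a2 b2
  have e3 := congrArg₂ (· * ·) a3 b3
  push_cast at e1 e2 e3
  have h1 : (2 * (n : ℝ) + 3) ≠ 0 := by positivity
  refine mul_left_cancel₀ h1 ?_
  have key : 2 * (2 * n + 3) * (n + 2)
        * ((n + 2 - (k + 1)).factorial / (n + 2 + (k + 1)).factorial : ℝ) * (u * u')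
      = 2 * ((n + 1 - (k + 1)).factorial / (n + 1 + (k + 1)).factorial : ℝ)
          * (((n + 2 - (k + 1)) * u + (n + 1 + (k + 1)) * v)
            * ((n + 2 - (k + 1)) * u' + (n + 1 + (k + 1)) * v'))
        + ((n + 1 - k).factorial / (n + 1 + k).factorial : ℝ) * ((u - v) * (u' - v'))
        + ((n + 1 - (k + 2)).factorial / (n + 1 + (k + 2)).factorial : ℝ)
          * (((n + 1 + (k + 1)) * (n + 2 + (k + 1)) * v - (n + 1 - (k + 1)) * (n + 2 - (k + 1)) * u)
            * ((n + 1 + (k + 1)) * (n + 2 + (k + 1)) * v'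
              - (n + 1 - (k + 1)) * (n + 2 - (k + 1)) * u'))
        - 2 * (2 * n + 3) * (n + 1)
          * ((n - (k + 1)).factorial / (n + (k + 1)).factorial : ℝ) * (v * v') := by
    have hf (j : ℕ) : (j.factorial : ℝ) ≠ 0 := by exact_mod_cast j.factorial_ne_zero
    -- For n ≤ k some factorials involve truncated differences. There v and v' vanish; k = n and k =
    -- n + 1 are boundary cases, and beyond them u vanishes too.
    rcases Nat.lt_or_ge n (k + 1) with hk | hk
    · rw [hva (by omega), hvb (by omega)]
      rcases Nat.lt_or_ge n k with hk1 | hk1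
      · rcases Nat.lt_or_ge (n + 1) k with hk2 | hk2
        · rw [hua (by omega)]
          ring
        · obtain rfl : k = n + 1 := by omega
          rw [show n + 2 - (n + 1 + 1) = 0 by omega, show n + 1 - (n + 1) = 0 by omega,
            show n + 1 - (n + 1 + 1) = 0 by omega,
            show n + 2 + (n + 1 + 1) = (n + 1 + (n + 1)) + 1 + 1 by omega,
            Nat.factorial_succ (_ + 1), Nat.factorial_succ (n + 1 + (n + 1))]
          have := hf (n + 1 + (n + 1))
          have h2 : (n : ℝ) + 2 ≠ 0 := by positivity
          push_cast
          field_simp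
          ring
      · obtain rfl : k = n := by omega
        rw [show k + 2 - (k + 1) = 1 by omega, show k + 1 - (k + 1) = 0 by omega,
          show k + 1 - k = 1 by omega, show k + 2 + (k + 1) = k + 1 + k + 1 + 1 by omega,
          show k + 1 + (k + 1) = k + 1 + k + 1 by omega,
          Nat.factorial_succ (_ + 1), Nat.factorial_succ (k + 1 + k)]
        have := hf (k + 1 + k)
        push_cast
        field_simp
        ring
    · obtain ⟨d, rfl⟩ := Nat.exists_eq_add_of_le hk
      rw [show k + 1 + d + 2 - (k + 1) = d + 1 + 1 by omega,
        show k + 1 + d + 1 - (k + 1) = d + 1 by omega,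
        show k + 1 + d + 1 - k = d + 1 + 1 by omega,
        show k + 1 + d + 1 - (k + 2) = d by omega, show k + 1 + d - (k + 1) = d by omega,
        show k + 1 + d + 2 + (k + 1) = k + 1 + d + (k + 1) + 1 + 1 by omega,
        show k + 1 + d + 1 + (k + 1) = k + 1 + d + (k + 1) + 1 by omega,
        show k + 1 + d + 1 + k = k + 1 + d + (k + 1) by omega,
        show k + 1 + d + 1 + (k + 2) = k + 1 + d + (k + 1) + 1 + 1 by omega,
        Nat.factorial_succ (k + 1 + d + (k + 1) + 1), Nat.factorial_succ (k + 1 + d + (k + 1)),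
        Nat.factorial_succ (d + 1), Nat.factorial_succ d]
      have := hf (k + 1 + d + (k + 1))
      have := hf d
      push_cast
      field_simp
      ring
  linear_combination (s * t) ^ (k + 1) / 2 * key
    - ((n + 1 - (k + 1)).factorial / (n + 1 + (k + 1)).factorial : ℝ) * (s * t) ^ (k + 1) * e1
    - ((n + 1 - (k + 2)).factorial / (n + 1 + (k + 2)).factorial : ℝ) * (s * t) ^ (k + 1) / 2 * e2
    - ((n + 1 - k).factorial / (n + 1 + k).factorial : ℝ) * (s * t) ^ (k + 1) / 2 * e3

theorem additionCoeff_recurrence {a b s t : ℝ} (hs : s ^ 2 = 1 - a ^ 2)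
    (ht : t ^ 2 = 1 - b ^ 2) (n : ℕ) (m : ℤ) :
    (n + 2) * additionCoeff a b s t (n + 2) m.natAbs
      = (2 * n + 3) * (a * b * additionCoeff a b s t (n + 1) m.natAbs
          + s * t / 2 * (additionCoeff a b s t (n + 1) (m - 1).natAbs
            + additionCoeff a b s t (n + 1) (m + 1).natAbs))
        - (n + 1) * additionCoeff a b s t n m.natAbs := by
  rcases lt_trichotomy m 0 with hm | rfl | hm
  · obtain ⟨k, hk⟩ : ∃ k : ℕ, m = -((k : ℤ) + 1) := ⟨(-m - 1).toNat, by omega⟩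
    rw [show m.natAbs = k + 1 by omega, show (m - 1).natAbs = k + 2 by omega,
      show (m + 1).natAbs = k by omega, additionCoeff_recurrence_succ hs ht]
    ring
  · rw [show ((0 : ℤ)).natAbs = 0 by rfl, show ((0 : ℤ) - 1).natAbs = 1 by rfl,
      show ((0 : ℤ) + 1).natAbs = 1 by rfl, additionCoeff_recurrence_zero hs ht]
    ring
  · obtain ⟨k, rfl⟩ : ∃ k : ℕ, m = (k : ℤ) + 1 := ⟨(m - 1).toNat, by omega⟩
    rw [show ((k : ℤ) + 1).natAbs = k + 1 by omega, show ((k : ℤ) + 1 - 1).natAbs = k by omega,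
      show ((k : ℤ) + 1 + 1).natAbs = k + 2 by omega, additionCoeff_recurrence_succ hs ht]

/-- The addition theorem for Legendre polynomials, as a Fourier series. -/
theorem hasSum_additionCoeff {a b s t : ℝ} (hs : s ^ 2 = 1 - a ^ 2) (ht : t ^ 2 = 1 - b ^ 2)
    (ψ : ℝ) (n : ℕ) :
    HasSum (fun m : ℤ => (additionCoeff a b s t n m.natAbs : ℂ) * Complex.exp (Complex.I * m * ψ))
      (((legendre n).eval (a * b + s * t * Real.cos ψ) : ℝ) : ℂ) := by
  set E : ℤ → ℂ := fun m => Complex.exp (Complex.I * m * ψ) with hE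
  have hE1 (m : ℤ) : E (m + 1) = E 1 * E m := by
    simp only [hE, ← Complex.exp_add]; congr 1; push_cast; ring
  have hE2 (m : ℤ) : E (m - 1) = E (-1) * E m := by
    simp only [hE, ← Complex.exp_add]; congr 1; push_cast; ring
  have hcos : (Real.cos ψ : ℂ) = (E 1 + E (-1)) / 2 := by
    rw [Complex.ofReal_cos, Complex.cos]
    simp only [hE]
    push_cast
    ring_nf
  have hE0 : E 0 = 1 := by simp [hE]
  change HasSum (fun m : ℤ => (additionCoeff a b s t n m.natAbs : ℂ) * E m) _
  induction n using Nat.twoStepInduction with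
  | zero =>
    have h := hasSum_sum_of_ne_finset_zero (L := SummationFilter.unconditional ℤ) (s := {0})
      (f := fun m : ℤ => (additionCoeff a b s t 0 m.natAbs : ℂ) * E m) fun m hm => by
        have hm' : m ≠ 0 := by simpa using hm
        simp only [additionCoeff_eq_zero a b s t (show 0 < m.natAbs by omega)]
        simp
    simpa [additionCoeff, legendreDeriv, legendre_zero, hE0] using h
  | one =>
    have h := hasSum_sum_of_ne_finset_zero (L := SummationFilter.unconditional ℤ) (s := {-1, 0, 1})
      (f := fun m : ℤ => (additionCoeff a b s t 1 m.natAbs : ℂ) * E m) fun m hm => by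
        simp only [Finset.mem_insert, Finset.mem_singleton, not_or] at hm
        simp only [additionCoeff_eq_zero a b s t (show 1 < m.natAbs by omega)]
        simp
    rw [Finset.sum_insert (by simp), Finset.sum_insert (by simp), Finset.sum_singleton] at h
    convert h using 1
    simp only [legendre_one, eval_X]
    push_cast
    rw [← Complex.ofReal_cos, hcos, hE0]
    simp [additionCoeff, legendreDeriv, legendre_one]
    ring
  | more n ih0 ih1 =>
    -- Multiplication by E 1 and E (-1) shifts the order by one; summing over all of ℤ leaves no
    -- boundary terms.
    have hp := ((Equiv.subRight (1 : ℤ)).hasSum_iff.2 ih1).mul_left (E 1)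
    have hm := ((Equiv.addRight (1 : ℤ)).hasSum_iff.2 ih1).mul_left (E (-1))
    have h := (((ih1.mul_left ((a * b : ℝ) : ℂ)).add
      ((hp.add hm).mul_left ((s * t / 2 : ℝ) : ℂ))).mul_left ((2 * n + 3 : ℝ) : ℂ)).sub
        (ih0.mul_left ((n + 1 : ℝ) : ℂ))
    have hn : ((n + 2 : ℝ) : ℂ) ≠ 0 := by exact_mod_cast (by positivity : (n + 2 : ℝ) ≠ 0)
    rw [← hasSum_mul_left_iff hn]
    have hval := congrArg (fun p => ((eval (a * b + s * t * Real.cos ψ) p : ℝ) : ℂ))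
      (legendre_add_two n)
    simp only [eval_mul, eval_sub, eval_add, eval_X, eval_natCast, eval_ofNat, eval_one] at hval
    push_cast at hval
    rw [← Complex.ofReal_cos, hcos] at hval
    convert! h using 1
    · ext m
      have hrec := congrArg (fun x : ℝ => (x : ℂ)) (additionCoeff_recurrence hs ht n m)
      have hEm : E 1 * E (-1) = 1 := by rw [← hE1, neg_add_cancel, hE0]
      simp only [Function.comp_apply, Equiv.subRight_apply, Equiv.coe_addRight, hE1, hE2]
      push_cast at hrec ⊢
      linear_combination E m * hrec - (2 * n + 3) * (s * t / 2)
        * (additionCoeff a b s t (n + 1) (m - 1).natAbs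
          + additionCoeff a b s t (n + 1) (m + 1).natAbs) * E m * hEm
    · push_cast
      linear_combination hval

theorem legendre_addition {a b s t : ℝ} (hs : s ^ 2 = 1 - a ^ 2) (ht : t ^ 2 = 1 - b ^ 2)
    (ψ : ℝ) (n : ℕ) :
    ∑ m ∈ Finset.Icc (-(n : ℤ)) n,
      (additionCoeff a b s t n m.natAbs : ℂ) * Complex.exp (Complex.I * m * ψ)
      = (((legendre n).eval (a * b + s * t * Real.cos ψ) : ℝ) : ℂ) := by
  refine HasSum.unique (hasSum_sum_of_ne_finset_zero fun m hm => ?_)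
    (hasSum_additionCoeff hs ht ψ n)
  rw [Finset.mem_Icc] at hm
  rw [additionCoeff_eq_zero a b s t (show n < m.natAbs by omega)]
  simp

/-- The signs (-1)^m square away and the two square roots multiply to one normalization. The polar
angles lie in [0, π], so √(1 - cos²) is the sine itself. -/
theorem sphericalHarmonic_mul_conj {θ θ' : ℝ} (hθ : θ ∈ Set.Icc 0 Real.pi)
    (hθ' : θ' ∈ Set.Icc 0 Real.pi) (φ φ' : ℝ) {n : ℕ} {m : ℤ} (hm : m ∈ Finset.Icc (-(n : ℤ)) n) :
    sphericalHarmonic n m θ φ * starRingEnd ℂ (sphericalHarmonic n m θ' φ')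
      = ((2 * n + 1) / (4 * Real.pi) : ℝ)
        * ((additionCoeff (Real.cos θ) (Real.cos θ') (Real.sin θ) (Real.sin θ') n m.natAbs : ℂ)
          * Complex.exp (Complex.I * m * ((φ - φ' : ℝ) : ℂ))) := by
  have hsqrt {x : ℝ} (hx : x ∈ Set.Icc 0 Real.pi) : √(1 - Real.cos x ^ 2) = Real.sin x := by
    rw [← Real.sin_sq, Real.sqrt_sq (Real.sin_nonneg_of_mem_Icc hx)]
  have hconj : starRingEnd ℂ (Complex.exp (Complex.I * m * φ'))
      = Complex.exp (-(Complex.I * m * φ')) := by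
    rw [← Complex.exp_conj]
    simp
  have hexp : Complex.exp (Complex.I * m * ((φ - φ' : ℝ) : ℂ))
      = Complex.exp (Complex.I * m * φ) * Complex.exp (-(Complex.I * m * φ')) := by
    rw [← Complex.exp_add]
    congr 1
    push_cast
    ring
  rw [Finset.mem_Icc] at hm
  set q : ℝ := (2 * n + 1) / (4 * Real.pi)
    * (((n : ℤ) - m).toNat.factorial / ((n : ℤ) + m).toNat.factorial) with hq
  have hq0 : 0 ≤ q := by have := Real.pi_pos; positivity
  have hreal : √q * assocLegendre n m (Real.cos θ) * (√q * assocLegendre n m (Real.cos θ'))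
      = (2 * n + 1) / (4 * Real.pi)
        * additionCoeff (Real.cos θ) (Real.cos θ') (Real.sin θ) (Real.sin θ') n m.natAbs := by
    have hf (j : ℕ) : (j.factorial : ℝ) ≠ 0 := by exact_mod_cast j.factorial_ne_zero
    rw [mul_mul_mul_comm, Real.mul_self_sqrt hq0, hq]
    rcases le_or_gt 0 m with h | h
    · obtain ⟨k, rfl⟩ := Int.eq_ofNat_of_zero_le h
      have h1 : ((-1 : ℝ) ^ k) * (-1) ^ k = 1 := by rw [← mul_pow]; simp
      rw [show ((n : ℤ) - k).toNat = n - k by omega, show ((n : ℤ) + k).toNat = n + k by omega]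
      simp only [assocLegendre, h, if_true, assocLegendreNat, hsqrt hθ, hsqrt hθ', Int.natAbs_natCast,
        additionCoeff, legendreDeriv, mul_pow]
      linear_combination ((2 * n + 1) / (4 * Real.pi)
        * ((n - k).factorial / (n + k).factorial : ℝ) * Real.sin θ ^ k * Real.sin θ' ^ k
        * (derivative^[k] (legendre n)).eval (Real.cos θ)
        * (derivative^[k] (legendre n)).eval (Real.cos θ')) * h1
    · obtain ⟨k, hk⟩ := Int.eq_ofNat_of_zero_le (neg_nonneg.2 h.le)
      obtain rfl : m = -(k : ℤ) := by omega
      have h1 : ((-1 : ℝ) ^ k) * (-1) ^ k = 1 := by rw [← mul_pow]; simp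
      rw [show ((n : ℤ) - -(k : ℤ)).toNat = n + k by omega,
        show ((n : ℤ) + -(k : ℤ)).toNat = n - k by omega]
      simp only [assocLegendre, not_le.2 h, if_false, assocLegendreNat, hsqrt hθ, hsqrt hθ',
        Int.natAbs_neg, Int.natAbs_natCast, additionCoeff, legendreDeriv, mul_pow]
      -- For order -k the normalization contributes A and the two associated functions contribute B
      -- each; A B = 1 leaves a single B, as for order k.
      have h2 : ((n + k).factorial / (n - k).factorial : ℝ) * ((n - k).factorial / (n + k).factorial)
          = 1 := by
        have := hf (n + k)
        have := hf (n - k)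
        field_simp
      generalize ((n + k).factorial / (n - k).factorial : ℝ) = A at *
      generalize ((n - k).factorial / (n + k).factorial : ℝ) = B at *
      generalize (derivative^[k] (legendre n)).eval (Real.cos θ) = u
      generalize (derivative^[k] (legendre n)).eval (Real.cos θ') = v
      generalize (2 * (n : ℝ) + 1) / (4 * Real.pi) = D
      generalize (-1 : ℝ) ^ k = e at *
      linear_combination (D * B * Real.sin θ ^ k * Real.sin θ' ^ k * u * v)
        * (h2 + A * B * (1 + e * e) * h1)
  rw [sphericalHarmonic, sphericalHarmonic, map_mul, hconj, Complex.conj_ofReal, hexp,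
    mul_mul_mul_comm, ← Complex.ofReal_mul, hreal]
  push_cast
  ring

/-- The addition theorem for spherical harmonics. -/
theorem sum_sphericalHarmonic_mul_conj {θ θ' : ℝ} (hθ : θ ∈ Set.Icc 0 Real.pi)
    (hθ' : θ' ∈ Set.Icc 0 Real.pi) (φ φ' : ℝ) (n : ℕ) :
    ∑ m ∈ Finset.Icc (-(n : ℤ)) n,
        sphericalHarmonic n m θ φ * starRingEnd ℂ (sphericalHarmonic n m θ' φ')
      = ((2 * n + 1) / (4 * Real.pi) * (legendre n).eval (Real.cos θ * Real.cos θ'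
        + Real.sin θ * Real.sin θ' * Real.cos (φ - φ')) : ℝ) := by
  rw [Finset.sum_congr rfl fun m hm => sphericalHarmonic_mul_conj hθ hθ' φ φ' hm,
    ← Finset.mul_sum, legendre_addition (Real.sin_sq θ) (Real.sin_sq θ'), Complex.ofReal_mul]

end AdditionTheorem

/-! ### The retarded potential as a Legendre series in the angle. -/

section RetardedPotential

open scoped ContDiff

theorem norm_sphericalPoint {r : ℝ} (hr : 0 ≤ r) (θ φ : ℝ) : ‖sphericalPoint r θ φ‖ = r := by
  rw [EuclideanSpace.norm_eq, Real.sqrt_eq_iff_mul_self_eq (by positivity) hr, eq_comm]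
  simp only [sphericalPoint, Fin.sum_univ_three, Real.norm_eq_abs, sq_abs]
  simp
  linear_combination (-r ^ 2 * Real.sin θ ^ 2) * Real.sin_sq_add_cos_sq φ
    - r ^ 2 * Real.sin_sq_add_cos_sq θ

theorem inner_sphericalPoint (r r' θ θ' φ φ' : ℝ) :
    inner ℝ (sphericalPoint r θ φ) (sphericalPoint r' θ' φ')
      = r * r' * (Real.cos θ * Real.cos θ' + Real.sin θ * Real.sin θ' * Real.cos (φ - φ')) := by
  rw [PiLp.inner_apply, Real.cos_sub]
  simp [sphericalPoint, Fin.sum_univ_three]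
  ring

theorem cos_angle_sphericalPoint {r r' : ℝ} (hr : 0 < r) (hr' : 0 < r') (θ θ' φ φ' : ℝ) :
    Real.cos (InnerProductGeometry.angle (sphericalPoint r θ φ) (sphericalPoint r' θ' φ'))
      = Real.cos θ * Real.cos θ' + Real.sin θ * Real.sin θ' * Real.cos (φ - φ') := by
  rw [InnerProductGeometry.cos_angle, inner_sphericalPoint, norm_sphericalPoint hr.le,
    norm_sphericalPoint hr'.le]
  field_simp

theorem dist_sphericalPoint {r r' : ℝ} (hr : 0 ≤ r) (hr' : 0 ≤ r') (θ θ' φ φ' : ℝ) :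
    dist (sphericalPoint r θ φ) (sphericalPoint r' θ' φ')
      = √(r ^ 2 + r' ^ 2 - 2 * r * r' * Real.cos (InnerProductGeometry.angle
          (sphericalPoint r θ φ) (sphericalPoint r' θ' φ'))) := by
  rw [dist_eq_norm, ← Real.sqrt_sq (norm_nonneg _), norm_sub_sq_real,
    ← InnerProductGeometry.cos_angle_mul_norm_mul_norm, norm_sphericalPoint hr,
    norm_sphericalPoint hr']
  ring_nf

/-- The travel time between points at distances `r` and `r'` from the origin whose directions
enclose an angle of cosine `y`. -/
def travelTime (c r r' y : ℝ) : ℝ := √(r ^ 2 + r' ^ 2 - 2 * r * r' * y) / c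

theorem two_mul_mul_mul_lt {r r' y : ℝ} (hr : 0 < r) (hr' : 0 < r')
    (hy : y < (r ^ 2 + r' ^ 2) / (2 * r * r')) : 0 < r ^ 2 + r' ^ 2 - 2 * r * r' * y := by
  rw [lt_div_iff₀ (by positivity)] at hy
  linarith

/-- This is where r ≠ r' enters: the distance stays positive slightly beyond y = 1, so the travel
time is smooth on an open set containing [-1, 1]. -/
theorem Icc_subset_Iio {r r' : ℝ} (hr : 0 < r) (hr' : 0 < r') (hne : r ≠ r') :
    Set.Icc (-1 : ℝ) 1 ⊆ Set.Iio ((r ^ 2 + r' ^ 2) / (2 * r * r')) := by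
  intro y hy
  refine lt_of_le_of_lt hy.2 ?_
  rw [lt_div_iff₀ (by positivity)]
  have := sq_pos_of_ne_zero (sub_ne_zero.2 hne)
  linarith

theorem hasDerivAt_travelTime {c r r' y : ℝ} (hc : 0 < c) (hr : 0 < r) (hr' : 0 < r')
    (hy : y < (r ^ 2 + r' ^ 2) / (2 * r * r')) :
    HasDerivAt (travelTime c r r') (-(r * r' / (c ^ 2 * travelTime c r r' y))) y := by
  have h0 := two_mul_mul_mul_lt hr hr' hy
  have h1 : HasDerivAt (fun y => r ^ 2 + r' ^ 2 - 2 * r * r' * y) (-(2 * r * r')) y := by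
    simpa using ((hasDerivAt_id y).const_mul (2 * r * r')).const_sub (r ^ 2 + r' ^ 2)
  refine ((h1.sqrt h0.ne').div_const c).congr_deriv ?_
  have := Real.sqrt_pos.2 h0
  rw [travelTime]
  field_simp

theorem contDiffOn_travelTime {c r r' : ℝ} (hr : 0 < r) (hr' : 0 < r') :
    ContDiffOn ℝ ∞ (travelTime c r r') (Set.Iio ((r ^ 2 + r' ^ 2) / (2 * r * r'))) := by
  refine ContDiffOn.div_const (ContDiffOn.sqrt (by fun_prop) fun y hy => ?_) c
  exact (two_mul_mul_mul_lt hr hr' hy).ne'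

theorem travelTime_pos {c r r' y : ℝ} (hc : 0 < c) (hr : 0 < r) (hr' : 0 < r')
    (hy : y < (r ^ 2 + r' ^ 2) / (2 * r * r')) : 0 < travelTime c r r' y :=
  div_pos (Real.sqrt_pos.2 (two_mul_mul_mul_lt hr hr' hy)) hc

theorem argument_travelTime {c r r' y : ℝ} (hc : 0 < c) (hr : 0 < r) (hr' : 0 < r')
    (hy : y < (r ^ 2 + r' ^ 2) / (2 * r * r')) :
    (r ^ 2 + r' ^ 2 - c ^ 2 * travelTime c r r' y ^ 2) / (2 * r * r') = y := by
  rw [travelTime, div_pow, Real.sq_sqrt (two_mul_mul_mul_lt hr hr' hy).le]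
  field_simp
  ring

theorem travelTime_one {c r r' : ℝ} : travelTime c r r' 1 = |r - r'| / c := by
  rw [travelTime, ← Real.sqrt_sq_eq_abs]
  ring_nf

theorem travelTime_neg_one {c r r' : ℝ} (hr : 0 < r) (hr' : 0 < r') :
    travelTime c r r' (-1) = (r + r') / c := by
  rw [travelTime, show r ^ 2 + r' ^ 2 - 2 * r * r' * -1 = (r + r') ^ 2 by ring,
    Real.sqrt_sq (by positivity)]

theorem abs_sub_div_le {c r r' : ℝ} (hc : 0 < c) (hr : 0 < r) (hr' : 0 < r') :
    |r - r'| / c ≤ (r + r') / c := by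
  gcongr
  rw [abs_le]
  constructor <;> linarith

theorem integral_mul_legendrePulse {c r r' : ℝ} (hc : 0 < c) (hr : 0 < r) (hr' : 0 < r') (n : ℕ)
    (f : ℝ → ℂ) :
    ∫ t, f t * (legendrePulse c r r' n t : ℂ)
      = ∫ t in (|r - r'| / c)..((r + r') / c), f t * (((legendre n).eval
          ((r ^ 2 + r' ^ 2 - c ^ 2 * t ^ 2) / (2 * r * r')) : ℝ) : ℂ) := by
  rw [intervalIntegral.integral_of_le (abs_sub_div_le hc hr hr'), ← integral_Icc_eq_integral_Ioc,
    ← integral_indicator measurableSet_Icc]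
  congr 1
  ext t
  by_cases ht : t ∈ Set.Icc (|r - r'| / c) ((r + r') / c) <;>
    simp [legendrePulse, pulse, Set.indicator, ht]

theorem legendrePulseDistribution_apply {c r r' : ℝ} (hc : 0 < c) (hr : 0 < r) (hr' : 0 < r')
    (n : ℕ) (f : 𝓢(ℝ, ℂ)) :
    legendrePulseDistribution c r r' n f
      = ∫ t in (|r - r'| / c)..((r + r') / c), f t * (((legendre n).eval
          ((r ^ 2 + r' ^ 2 - c ^ 2 * t ^ 2) / (2 * r * r')) : ℝ) : ℂ) := by
  rw [legendrePulseDistribution, Lp.toTemperedDistribution_apply,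
    ← integral_mul_legendrePulse hc hr hr']
  refine integral_congr_ae ?_
  filter_upwards [(memLp_legendrePulse c r r' n).coeFn_toLp] with t ht
  rw [ht, smul_eq_mul]

/-- A test function of time, as a function of the cosine of the angle between the two points. -/
def angularProfile (c r r' : ℝ) (f : ℝ → ℂ) (y : ℝ) : ℂ :=
  ((r * r' / (c ^ 2 * travelTime c r r' y) : ℝ) : ℂ) * f (travelTime c r r' y)

theorem contDiffOn_angularProfile {c r r' : ℝ} (hc : 0 < c) (hr : 0 < r) (hr' : 0 < r')
    {f : ℝ → ℂ} (hf : ContDiff ℝ ∞ f) :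
    ContDiffOn ℝ ∞ (angularProfile c r r' f) (Set.Iio ((r ^ 2 + r' ^ 2) / (2 * r * r'))) := by
  have h := contDiffOn_travelTime (c := c) hr hr'
  refine ContDiffOn.mul ?_ (hf.comp_contDiffOn h)
  refine Complex.ofRealCLM.contDiff.comp_contDiffOn ?_
  refine contDiffOn_const.div (contDiffOn_const.mul h) fun y hy => ?_
  have := travelTime_pos hc hr hr' hy
  positivity

/-- The change of variables t = `travelTime c r r' y`. The weight in `angularProfile` is minus its
derivative; the sign is absorbed by the exchange of endpoints, since y = 1 corresponds to the
shortest time. -/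
theorem legendreCoeff_angularProfile {c r r' : ℝ} (hc : 0 < c) (hr : 0 < r) (hr' : 0 < r')
    (hne : r ≠ r') (n : ℕ) (f : 𝓢(ℝ, ℂ)) :
    legendreCoeff (angularProfile c r r' f) n = legendrePulseDistribution c r r' n f := by
  have hsub := Icc_subset_Iio hr hr' hne
  rw [legendrePulseDistribution_apply hc hr hr', ← travelTime_one,
    ← travelTime_neg_one hr hr', intervalIntegral.integral_symm]
  have hcont : Continuous fun t => f t * (((legendre n).eval
      ((r ^ 2 + r' ^ 2 - c ^ 2 * t ^ 2) / (2 * r * r')) : ℝ) : ℂ) :=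
    f.continuous.mul ((continuous_ofReal_eval (legendre n)).comp (by fun_prop))
  rw [← intervalIntegral.integral_deriv_smul_comp (fun y hy => hasDerivAt_travelTime hc hr hr'
    (hsub (uIcc_neg_one_one ▸ hy))) ?_ hcont, ← intervalIntegral.integral_neg, legendreCoeff]
  · refine intervalIntegral.integral_congr fun y hy => ?_
    have hy' := hsub (uIcc_neg_one_one ▸ hy)
    simp only [Function.comp_apply, argument_travelTime hc hr hr' hy', angularProfile,
      Complex.real_smul]
    push_cast
    ring
  · intro y hy
    have hy' := hsub (uIcc_neg_one_one ▸ hy)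
    have := (travelTime_pos hc hr hr' hy').ne'
    refine ContinuousAt.continuousWithinAt ?_
    have hc1 := (hasDerivAt_travelTime hc hr hr' hy').continuousAt
    exact (continuousAt_const.div (continuousAt_const.mul hc1)
      (mul_ne_zero (pow_ne_zero 2 hc.ne') this)).neg

theorem hasSum_temperedDistribution_iff {ι : Type*} {u : ι → 𝓢'(ℝ, ℂ)} {v : 𝓢'(ℝ, ℂ)} :
    HasSum u v ↔ ∀ f : 𝓢(ℝ, ℂ), HasSum (fun i => u i f) (v f) := by
  simp only [HasSum]
  rw [PointwiseConvergenceCLM.tendsto_iff_forall_tendsto]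
  refine forall_congr' fun f => ?_
  have (s : Finset ι) : (∑ i ∈ s, u i) f = ∑ i ∈ s, u i f :=
    map_sum (PointwiseConvergenceCLM.evalCLM (RingHom.id ℂ) ℂ f) u s
  simp only [this]

/-- The topology is pointwise, so f may be fixed. The factor c/(4πrr') turns the profile at x into
f(R/c)/(4πR) and the weight (2n + 1)/2 into the stated coefficient. -/
theorem hasSum_retardedPotential {c r r' : ℝ} (hc : 0 < c) (hr : 0 < r) (hr' : 0 < r')
    (hne : r ≠ r') {x : ℝ} (hx : x ∈ Set.Icc (-1 : ℝ) 1) :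
    HasSum (fun n : ℕ => (((2 * n + 1) * c / (8 * Real.pi * r * r') * (legendre n).eval x : ℝ) : ℂ)
        • legendrePulseDistribution c r r' n)
      (retardedPotential c √(r ^ 2 + r' ^ 2 - 2 * r * r' * x)) := by
  rw [hasSum_temperedDistribution_iff]
  intro f
  have hxm := Icc_subset_Iio hr hr' hne hx
  have h := (hasSum_legendre isOpen_Iio (Icc_subset_Iio hr hr' hne)
    (contDiffOn_angularProfile hc hr hr' f.smooth') hx).mul_left ((c / (4 * Real.pi * r * r') : ℝ) : ℂ)
  convert! h using 1
  · ext n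
    change (_ : ℂ) * legendrePulseDistribution c r r' n f
      = (_ : ℂ) * ((_ : ℂ) * legendreCoeff (angularProfile c r r' f) n)
    rw [legendreCoeff_angularProfile hc hr hr' hne]
    rw [← mul_assoc, ← Complex.ofReal_mul]
    congr 2
    field_simp
    ring
  · change ((1 / (4 * Real.pi * √(r ^ 2 + r' ^ 2 - 2 * r * r' * x)) : ℝ) : ℂ)
      * f (travelTime c r r' x) = _
    rw [angularProfile, ← mul_assoc, ← Complex.ofReal_mul]
    congr 2
    have := Real.sqrt_pos.2 (two_mul_mul_mul_lt hr hr' hxm)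
    have := Real.pi_pos
    rw [travelTime]
    field_simp

theorem hasSum_retardedPotential_legendre {c r r' : ℝ} (hc : 0 < c) (hr : 0 < r) (hr' : 0 < r')
    (hne : r ≠ r') (θ θ' φ φ' : ℝ) :
    HasSum (fun n : ℕ => (((2 * n + 1) * c / (8 * Real.pi * r * r')
          * (legendre n).eval (Real.cos (InnerProductGeometry.angle
            (sphericalPoint r θ φ) (sphericalPoint r' θ' φ'))) : ℝ) : ℂ)
        • legendrePulseDistribution c r r' n)
      (retardedPotential c (dist (sphericalPoint r θ φ) (sphericalPoint r' θ' φ'))) := by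
  rw [dist_sphericalPoint hr.le hr'.le]
  exact hasSum_retardedPotential hc hr hr' hne ⟨Real.neg_one_le_cos _, Real.cos_le_one _⟩

theorem hasSum_retardedPotential_sphericalHarmonic {c r r' : ℝ} (hc : 0 < c) (hr : 0 < r)
    (hr' : 0 < r') (hne : r ≠ r') {θ θ' : ℝ} (hθ : θ ∈ Set.Icc 0 Real.pi)
    (hθ' : θ' ∈ Set.Icc 0 Real.pi) (φ φ' : ℝ) :
    HasSum (fun n : ℕ => ∑ m ∈ Finset.Icc (-(n : ℤ)) n,
          (((c / (2 * r * r') : ℝ) : ℂ) * sphericalHarmonic n m θ φ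
              * starRingEnd ℂ (sphericalHarmonic n m θ' φ'))
            • legendrePulseDistribution c r r' n)
      (retardedPotential c (dist (sphericalPoint r θ φ) (sphericalPoint r' θ' φ'))) := by
  convert hasSum_retardedPotential_legendre hc hr hr' hne θ θ' φ φ' using 2 with n
  rw [← Finset.sum_smul]
  congr 1
  simp only [mul_assoc ((c / (2 * r * r') : ℝ) : ℂ)]
  rw [← Finset.mul_sum, sum_sphericalHarmonic_mul_conj hθ hθ', cos_angle_sphericalPoint hr hr',
    ← Complex.ofReal_mul]
  congr 1
  have := Real.pi_pos
  field_simp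
  ring

end RetardedPotential

/-! ### Recurrences and derivatives of spherical Bessel and Hankel functions. -/

section SphericalBessel

open scoped ContDiff

/-- The operator `(1 / x) d / dx`. -/
def rayleighOp (g : ℝ → ℝ) : ℝ → ℝ := fun y => deriv g y / y

theorem rayleigh_eq (n : ℕ) (f : ℝ → ℝ) (x : ℝ) :
    rayleigh n f x = (-x) ^ n * (rayleighOp^[n] f) x := rfl

theorem contDiffOn_iterate_rayleighOp {f : ℝ → ℝ} (hf : ContDiffOn ℝ ∞ f {0}ᶜ) (n : ℕ) :
    ContDiffOn ℝ ∞ (rayleighOp^[n] f) {0}ᶜ := by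
  induction n with
  | zero => exact hf
  | succ n ih =>
    rw [Function.iterate_succ_apply']
    exact (ih.deriv_of_isOpen isOpen_compl_singleton (by simp)).div contDiffOn_id fun x hx => hx

theorem hasDerivAt_iterate_rayleighOp {f : ℝ → ℝ} (hf : ContDiffOn ℝ ∞ f {0}ᶜ) (n : ℕ) {x : ℝ}
    (hx : x ≠ 0) : HasDerivAt (rayleighOp^[n] f) (x * (rayleighOp^[n + 1] f) x) x := by
  have h := (((contDiffOn_iterate_rayleighOp hf n).contDiffAt
    (isOpen_compl_singleton.mem_nhds hx)).differentiableAt (by simp)).hasDerivAt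
  refine h.congr_deriv ?_
  rw [Function.iterate_succ_apply', rayleighOp]
  field_simp

/-- Only the product rule enters, whatever the smooth f; the three-term recurrence, in contrast,
needs the radial equation. -/
theorem hasDerivAt_rayleigh {f : ℝ → ℝ} (hf : ContDiffOn ℝ ∞ f {0}ᶜ) (n : ℕ) {x : ℝ}
    (hx : x ≠ 0) :
    HasDerivAt (rayleigh n f) (n / x * rayleigh n f x - rayleigh (n + 1) f x) x := by
  have h := ((hasDerivAt_id x).neg.pow n).mul (hasDerivAt_iterate_rayleighOp hf n hx)
  refine h.congr_deriv ?_
  simp only [rayleigh_eq]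
  rcases n with _ | n
  · simp
  · simp
    field_simp
    ring

/-- The equation `f'' + (2 / x) f' + f = 0`, in terms of `(1 / x) d / dx`. -/
def SolvesRadialEquation (f : ℝ → ℝ) : Prop :=
  ContDiffOn ℝ ∞ f {0}ᶜ ∧
    ∀ x ≠ 0, x ^ 2 * (rayleighOp^[2] f) x = -3 * rayleighOp f x - f x

/-- Apply (1/x) d/dx to the relation of order n: the factor x² yields an extra 2, which raises 2n +
3 to 2n + 5. -/
theorem SolvesRadialEquation.iterate {f : ℝ → ℝ} (hf : SolvesRadialEquation f) (n : ℕ) :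
    ∀ x ≠ 0, x ^ 2 * (rayleighOp^[n + 2] f) x
      = -(2 * n + 3) * (rayleighOp^[n + 1] f) x - (rayleighOp^[n] f) x := by
  induction n with
  | zero => intro x hx; simpa using hf.2 x hx
  | succ n ih =>
    intro x hx
    have h1 := ((hasDerivAt_id x).pow 2).mul (hasDerivAt_iterate_rayleighOp hf.1 (n + 2) hx)
    have h2 := ((hasDerivAt_iterate_rayleighOp hf.1 (n + 1) hx).const_mul
      (-(2 * (n : ℝ) + 3))).sub (hasDerivAt_iterate_rayleighOp hf.1 n hx)
    have heq : (fun y => y ^ 2 * (rayleighOp^[n + 2] f) y) =ᶠ[nhds x] fun y =>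
        -(2 * n + 3) * (rayleighOp^[n + 1] f) y - (rayleighOp^[n] f) y := by
      filter_upwards [isOpen_compl_singleton.mem_nhds hx] with y hy using ih y hy
    have h3 := h1.unique (h2.congr_of_eventuallyEq heq)
    simp only [Nat.cast_ofNat, id, Pi.pow_apply, Nat.add_one_sub_one, pow_one, mul_one] at h3
    refine mul_left_cancel₀ hx ?_
    push_cast
    linear_combination h3

theorem SolvesRadialEquation.rayleigh_add_two {f : ℝ → ℝ} (hf : SolvesRadialEquation f) (n : ℕ)
    {x : ℝ} (hx : x ≠ 0) :
    rayleigh (n + 2) f x = (2 * n + 3) / x * rayleigh (n + 1) f x - rayleigh n f x := by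
  have h := hf.iterate n x hx
  simp only [rayleigh_eq]
  have e : (2 * (n : ℝ) + 3) / x * ((-x) ^ (n + 1) * (rayleighOp^[n + 1] f) x)
      = -(2 * n + 3) * (-x) ^ n * (rayleighOp^[n + 1] f) x := by
    rw [pow_succ]; field_simp
  rw [e]
  linear_combination (-x) ^ n * h

theorem hasDerivAt_sin_div {x : ℝ} (hx : x ≠ 0) :
    HasDerivAt (fun y => Real.sin y / y) ((x * Real.cos x - Real.sin x) / x ^ 2) x :=
  ((Real.hasDerivAt_sin x).div (hasDerivAt_id x) hx).congr_deriv (by simp; ring)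

theorem hasDerivAt_cos_div {x : ℝ} (hx : x ≠ 0) :
    HasDerivAt (fun y => Real.cos y / y) ((-x * Real.sin x - Real.cos x) / x ^ 2) x :=
  ((Real.hasDerivAt_cos x).div (hasDerivAt_id x) hx).congr_deriv (by simp; ring)

theorem solvesRadialEquation_sin_div : SolvesRadialEquation fun y => Real.sin y / y := by
  refine ⟨Real.contDiff_sin.contDiffOn.div contDiffOn_id fun x hx => hx, fun x hx => ?_⟩
  have h1 {y : ℝ} (hy : y ≠ 0) : rayleighOp (fun y => Real.sin y / y) y
      = (y * Real.cos y - Real.sin y) / y ^ 3 := by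
    rw [rayleighOp, (hasDerivAt_sin_div hy).deriv]; field_simp
  have heq : rayleighOp (fun y => Real.sin y / y) =ᶠ[nhds x]
      fun y => (y * Real.cos y - Real.sin y) / y ^ 3 := by
    filter_upwards [isOpen_compl_singleton.mem_nhds hx] with y hy using h1 hy
  have h2 : HasDerivAt (fun y => (y * Real.cos y - Real.sin y) / y ^ 3) _ x :=
    (((hasDerivAt_id x).mul (Real.hasDerivAt_cos x)).sub (Real.hasDerivAt_sin x)).div
      ((hasDerivAt_id x).pow 3) (pow_ne_zero 3 hx)
  rw [Function.iterate_succ_apply', Function.iterate_one, rayleighOp, heq.deriv_eq, h2.deriv, h1 hx]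
  simp
  field_simp
  ring

theorem solvesRadialEquation_cos_div : SolvesRadialEquation fun y => Real.cos y / y := by
  refine ⟨Real.contDiff_cos.contDiffOn.div contDiffOn_id fun x hx => hx, fun x hx => ?_⟩
  have h1 {y : ℝ} (hy : y ≠ 0) : rayleighOp (fun y => Real.cos y / y) y
      = (-y * Real.sin y - Real.cos y) / y ^ 3 := by
    rw [rayleighOp, (hasDerivAt_cos_div hy).deriv]; field_simp
  have heq : rayleighOp (fun y => Real.cos y / y) =ᶠ[nhds x]
      fun y => (-y * Real.sin y - Real.cos y) / y ^ 3 := by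
    filter_upwards [isOpen_compl_singleton.mem_nhds hx] with y hy using h1 hy
  have h2 : HasDerivAt (fun y => (-y * Real.sin y - Real.cos y) / y ^ 3) _ x :=
    (((hasDerivAt_id x).neg.mul (Real.hasDerivAt_sin x)).sub (Real.hasDerivAt_cos x)).div
      ((hasDerivAt_id x).pow 3) (pow_ne_zero 3 hx)
  rw [Function.iterate_succ_apply', Function.iterate_one, rayleighOp, heq.deriv_eq, h2.deriv, h1 hx]
  simp
  field_simp
  ring

theorem z1_of_ne_zero (n : ℕ) {x : ℝ} (hx : x ≠ 0) :
    z1 n x = (rayleigh n (fun y => Real.sin y / y) x : ℂ) := by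
  simp [z1, sphericalBesselJ, hx]

theorem z4_of_ne_zero (n : ℕ) {x : ℝ} (hx : x ≠ 0) :
    z4 n x = (rayleigh n (fun y => Real.sin y / y) x : ℂ)
      + Complex.I * (rayleigh n (fun y => Real.cos y / y) x : ℂ) := by
  simp [z4, sphericalBesselJ, sphericalBesselY, hx]

theorem z1_add_two (n : ℕ) {x : ℝ} (hx : x ≠ 0) :
    z1 (n + 2) x = (2 * n + 3) / x * z1 (n + 1) x - z1 n x := by
  simp only [z1_of_ne_zero _ hx]
  rw [solvesRadialEquation_sin_div.rayleigh_add_two n hx]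
  push_cast
  ring

theorem z4_add_two (n : ℕ) {x : ℝ} (hx : x ≠ 0) :
    z4 (n + 2) x = (2 * n + 3) / x * z4 (n + 1) x - z4 n x := by
  simp only [z4_of_ne_zero _ hx]
  rw [solvesRadialEquation_sin_div.rayleigh_add_two n hx,
    solvesRadialEquation_cos_div.rayleigh_add_two n hx]
  push_cast
  ring

theorem hasDerivAt_z1 (n : ℕ) {x : ℝ} (hx : x ≠ 0) :
    HasDerivAt (z1 n) (n / x * z1 n x - z1 (n + 1) x) x := by
  have h := (hasDerivAt_rayleigh solvesRadialEquation_sin_div.1 n hx).ofReal_comp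
  refine (h.congr_of_eventuallyEq ?_).congr_deriv ?_
  · filter_upwards [isOpen_compl_singleton.mem_nhds hx] with y hy using z1_of_ne_zero n hy
  · simp only [z1_of_ne_zero _ hx]
    push_cast
    rfl

theorem hasDerivAt_z4 (n : ℕ) {x : ℝ} (hx : x ≠ 0) :
    HasDerivAt (z4 n) (n / x * z4 n x - z4 (n + 1) x) x := by
  have h := (hasDerivAt_rayleigh solvesRadialEquation_sin_div.1 n hx).ofReal_comp.add
    ((hasDerivAt_rayleigh solvesRadialEquation_cos_div.1 n hx).ofReal_comp.const_mul Complex.I)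
  refine (h.congr_of_eventuallyEq ?_).congr_deriv ?_
  · filter_upwards [isOpen_compl_singleton.mem_nhds hx] with y hy using z4_of_ne_zero n hy
  · simp only [z4_of_ne_zero _ hx]
    push_cast
    ring

theorem z1_zero {x : ℝ} (hx : x ≠ 0) : z1 0 x = Complex.sin x / x := by
  simp [z1_of_ne_zero _ hx, rayleigh]

theorem z4_zero {x : ℝ} (hx : x ≠ 0) :
    z4 0 x = Complex.sin x / x + Complex.I * (Complex.cos x / x) := by
  simp [z4_of_ne_zero _ hx, rayleigh]

theorem z1_one {x : ℝ} (hx : x ≠ 0) :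
    z1 1 x = -((x * Complex.cos x - Complex.sin x) / x ^ 2) := by
  have hx' : (x : ℂ) ≠ 0 := by exact_mod_cast hx
  rw [z1_of_ne_zero _ hx, rayleigh, Function.iterate_one, (hasDerivAt_sin_div hx).deriv]
  push_cast
  field_simp

theorem z4_one {x : ℝ} (hx : x ≠ 0) :
    z4 1 x = -((x * Complex.cos x - Complex.sin x) / x ^ 2)
      - Complex.I * ((-x * Complex.sin x - Complex.cos x) / x ^ 2) := by
  have hx' : (x : ℂ) ≠ 0 := by exact_mod_cast hx
  rw [z4_of_ne_zero _ hx, rayleigh, Function.iterate_one, (hasDerivAt_sin_div hx).deriv,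
    rayleigh, Function.iterate_one, (hasDerivAt_cos_div hx).deriv]
  push_cast
  field_simp
  ring

end SphericalBessel

/-! ### The Fourier integral of P_n along the law of cosines. -/

section RadialIntegral

/-- The cosine of the angle between two vectors of lengths `r` and `r'` at distance `s`. -/
def cosineLaw (r r' s : ℝ) : ℝ := (r ^ 2 + r' ^ 2 - s ^ 2) / (2 * r * r')

/-- The integral of `P_n (X (s)) exp (-i k s)` over the possible distances `s`. -/
def radialIntegral (r r' : ℝ) (n : ℕ) (k : ℝ) : ℂ :=
  ∫ s in (r - r')..(r + r'), (((legendre n).eval (cosineLaw r r' s) : ℝ) : ℂ)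
    * Complex.exp (-(Complex.I * k * s))

theorem continuous_cosineLaw (r r' : ℝ) : Continuous (cosineLaw r r') := by
  unfold cosineLaw; fun_prop

theorem hasDerivAt_radialIntegral (r r' : ℝ) (n : ℕ) (k : ℝ) :
    HasDerivAt (radialIntegral r r' n)
      (-Complex.I * ∫ s in (r - r')..(r + r'), s * ((((legendre n).eval (cosineLaw r r' s) : ℝ) : ℂ)
        * Complex.exp (-(Complex.I * k * s)))) k := by
  have hP : Continuous fun s => (((legendre n).eval (cosineLaw r r' s) : ℝ) : ℂ) :=
    (continuous_ofReal_eval _).comp (continuous_cosineLaw r r')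
  have hF (k : ℝ) : Continuous fun s : ℝ => (((legendre n).eval (cosineLaw r r' s) : ℝ) : ℂ)
      * Complex.exp (-(Complex.I * k * s)) := hP.mul (by fun_prop)
  have hF' (k : ℝ) : Continuous fun s : ℝ => (((legendre n).eval (cosineLaw r r' s) : ℝ) : ℂ)
      * (Complex.exp (-(Complex.I * k * s)) * (-(Complex.I * s))) := hP.mul (by fun_prop)
  have hnorm (k s : ℝ) : ‖Complex.exp (-(Complex.I * k * s))‖ = 1 := by
    rw [show -(Complex.I * k * s) = ((-(k * s) : ℝ) : ℂ) * Complex.I by push_cast; ring,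
      Complex.norm_exp_ofReal_mul_I]
  have h := (intervalIntegral.hasDerivAt_integral_of_dominated_loc_of_deriv_le
    (μ := volume) (a := r - r') (b := r + r') (x₀ := k) (s := Set.univ)
    (F := fun (k s : ℝ) => (((legendre n).eval (cosineLaw r r' s) : ℝ) : ℂ)
      * Complex.exp (-(Complex.I * k * s)))
    (F' := fun (k s : ℝ) => (((legendre n).eval (cosineLaw r r' s) : ℝ) : ℂ)
      * (Complex.exp (-(Complex.I * k * s)) * (-(Complex.I * s))))
    (bound := fun s => ‖(((legendre n).eval (cosineLaw r r' s) : ℝ) : ℂ)‖ * |s|)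
    Filter.univ_mem (Filter.Eventually.of_forall fun k => (hF k).aestronglyMeasurable)
    ((hF k).intervalIntegrable _ _) (hF' k).aestronglyMeasurable
    (Filter.Eventually.of_forall fun s _ k _ => ?_)
    ((hP.norm.mul continuous_abs).intervalIntegrable _ _)
    (Filter.Eventually.of_forall fun s _ k _ => ?_)).2
  · refine h.congr_deriv ?_
    rw [← intervalIntegral.integral_const_mul]
    congr 1
    ext s
    ring
  · simp only [norm_mul, hnorm, one_mul, norm_neg, Complex.norm_I, Complex.norm_real,
      Real.norm_eq_abs, le_refl]
  · have h1 : HasDerivAt (fun k : ℝ => -(Complex.I * k * s)) (-(Complex.I * s)) k := by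
      have := (((hasDerivAt_id k).ofReal_comp.const_mul Complex.I).mul_const (s : ℂ)).neg
      simpa using! this
    exact h1.cexp.const_mul _

theorem hasDerivAt_exp_neg (k s : ℝ) :
    HasDerivAt (fun s : ℝ => Complex.exp (-(Complex.I * k * s)))
      (-(Complex.I * k) * Complex.exp (-(Complex.I * k * s))) s := by
  have h1 : HasDerivAt (fun s : ℝ => -(Complex.I * k * s)) (-(Complex.I * k)) s := by
    have := ((hasDerivAt_id s).ofReal_comp.const_mul (Complex.I * k)).neg
    simpa using! this
  exact h1.cexp.congr_deriv (mul_comm _ _)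

theorem hasDerivAt_cosineLaw (r r' s : ℝ) : HasDerivAt (cosineLaw r r') (-(s / (r * r'))) s := by
  have h := (((hasDerivAt_id s).pow 2).const_sub (r ^ 2 + r' ^ 2)).div_const (2 * r * r')
  refine h.congr_deriv ?_
  simp
  ring

theorem cosineLaw_sub {r r' : ℝ} (hr : r ≠ 0) (hr' : r' ≠ 0) : cosineLaw r r' (r - r') = 1 := by
  rw [cosineLaw]; field_simp; ring

theorem cosineLaw_add {r r' : ℝ} (hr : r ≠ 0) (hr' : r' ≠ 0) : cosineLaw r r' (r + r') = -1 := by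
  rw [cosineLaw]; field_simp; ring

theorem integral_mul_sub_mul_sub {u v w : ℝ → ℂ} (hu : Continuous u) (hv : Continuous v)
    (hw : Continuous w) (p q : ℂ) (a b : ℝ) :
    ∫ s in a..b, (p * u s - q * (v s - w s))
      = p * (∫ s in a..b, u s) - q * ((∫ s in a..b, v s) - ∫ s in a..b, w s) := by
  have h1 : Continuous fun s => p * u s := continuous_const.mul hu
  have h2 : Continuous fun s => q * (v s - w s) := continuous_const.mul (hv.sub hw)
  rw [intervalIntegral.integral_sub (h1.intervalIntegrable _ _) (h2.intervalIntegrable _ _),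
    intervalIntegral.integral_const_mul, intervalIntegral.integral_const_mul,
    intervalIntegral.integral_sub (hv.intervalIntegrable _ _) (hw.intervalIntegrable _ _)]

/-- Integrate the derivative of (P_{n+2} - P_n)(X(s)) exp(-iks). The boundary terms vanish since
P_{n+2} and P_n agree at ±1; P_{n+2}' - P_n' = (2n + 3)P_{n+1}, and the factor s in X'(s) is the one
produced by differentiating in k. -/
theorem radialIntegral_add_two {r r' : ℝ} (hr : r ≠ 0) (hr' : r' ≠ 0) (n : ℕ) (k : ℝ) :
    k * r * r' * (radialIntegral r r' (n + 2) k - radialIntegral r r' n k)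
      = -(2 * n + 3) * deriv (radialIntegral r r' (n + 1)) k := by
  rw [(hasDerivAt_radialIntegral r r' (n + 1) k).deriv]
  have hcont (m : ℕ) : Continuous fun s : ℝ => (((legendre m).eval (cosineLaw r r' s) : ℝ) : ℂ)
      * Complex.exp (-(Complex.I * k * s)) :=
    ((continuous_ofReal_eval _).comp (continuous_cosineLaw r r')).mul (by fun_prop)
  have hcont' : Continuous fun s : ℝ => (s : ℂ)
      * ((((legendre (n + 1)).eval (cosineLaw r r' s) : ℝ) : ℂ)
      * Complex.exp (-(Complex.I * k * s))) := Complex.continuous_ofReal.mul (hcont (n + 1))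
  have hder (s : ℝ) : HasDerivAt (fun s => (((legendre (n + 2) - legendre n).eval
        (cosineLaw r r' s) : ℝ) : ℂ) * Complex.exp (-(Complex.I * k * s)))
      (-((2 * n + 3) / (r * r')) * (s * ((((legendre (n + 1)).eval (cosineLaw r r' s) : ℝ) : ℂ)
          * Complex.exp (-(Complex.I * k * s))))
        - Complex.I * k * ((((legendre (n + 2)).eval (cosineLaw r r' s) : ℝ) : ℂ)
            * Complex.exp (-(Complex.I * k * s))
          - (((legendre n).eval (cosineLaw r r' s) : ℝ) : ℂ)
            * Complex.exp (-(Complex.I * k * s)))) s := by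
    have h1 := (((legendre (n + 2) - legendre n).hasDerivAt (cosineLaw r r' s)).comp s
      (hasDerivAt_cosineLaw r r' s)).ofReal_comp.mul (hasDerivAt_exp_neg k s)
    refine h1.congr_deriv ?_
    rw [derivative_sub, derivative_legendre_add_two]
    simp
    ring
  have hi := intervalIntegral.integral_eq_sub_of_hasDerivAt (a := r - r') (b := r + r')
    (fun s _ => hder s) (Continuous.intervalIntegrable ((continuous_const.mul hcont').sub
      (continuous_const.mul ((hcont (n + 2)).sub (hcont n)))) _ _)
  rw [integral_mul_sub_mul_sub hcont' (hcont (n + 2)) (hcont n), cosineLaw_sub hr hr',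
    cosineLaw_add hr hr'] at hi
  simp only [eval_sub, eval_one_legendre, eval_neg_one_legendre] at hi
  simp only [radialIntegral]
  have hrc : (r : ℂ) ≠ 0 := by exact_mod_cast hr
  have hrc' : (r' : ℂ) ≠ 0 := by exact_mod_cast hr'
  have e : ((-1 : ℝ) ^ (n + 2) - (-1) ^ n) = 0 := by ring
  rw [e] at hi
  simp only [Complex.ofReal_zero, zero_mul, sub_self] at hi
  generalize (∫ s in (r - r')..(r + r'), (s : ℂ)
      * ((((legendre (n + 1)).eval (cosineLaw r r' s) : ℝ) : ℂ)
      * Complex.exp (-(Complex.I * k * s)))) = J at *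
  field_simp at hi
  linear_combination Complex.I * hi + (k * r * r' * ((∫ s in (r - r')..(r + r'),
    (((legendre (n + 2)).eval (cosineLaw r r' s) : ℝ) : ℂ) * Complex.exp (-(Complex.I * k * s)))
    - ∫ s in (r - r')..(r + r'),
    (((legendre n).eval (cosineLaw r r' s) : ℝ) : ℂ) * Complex.exp (-(Complex.I * k * s))))
      * Complex.I_sq

/-- The radial factor of the expansion of a spherical wave. -/
def radialProduct (r r' : ℝ) (n : ℕ) (k : ℝ) : ℂ :=
  2 * r * r' * (-Complex.I * k * z4 n (k * r) * z1 n (k * r'))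

theorem hasDerivAt_radialProduct {r r' k : ℝ} (hr : r ≠ 0) (hr' : r' ≠ 0) (hk : k ≠ 0)
    (n : ℕ) : HasDerivAt (radialProduct r r' n)
      (-Complex.I * (2 * r * r') * ((2 * n + 1) * z4 n (k * r) * z1 n (k * r')
        - k * r * z4 (n + 1) (k * r) * z1 n (k * r')
        - k * r' * z4 n (k * r) * z1 (n + 1) (k * r'))) k := by
  have hx (a : ℝ) : HasDerivAt (fun k : ℝ => k * a) a k := by
    simpa using (hasDerivAt_id k).mul_const a
  have h4 := (hasDerivAt_z4 n (mul_ne_zero hk hr)).scomp k (hx r)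
  have h1 := (hasDerivAt_z1 n (mul_ne_zero hk hr')).scomp k (hx r')
  have h := (((((hasDerivAt_id k).ofReal_comp).const_mul (-Complex.I)).mul h4).mul h1).const_mul
    (2 * r * r' : ℂ)
  have hrc : (r : ℂ) ≠ 0 := by exact_mod_cast hr
  have hrc' : (r' : ℂ) ≠ 0 := by exact_mod_cast hr'
  have hkc : (k : ℂ) ≠ 0 := by exact_mod_cast hk
  refine h.congr_deriv ?_
  simp
  field_simp
  ring

/-- The same recurrence as for `radialIntegral`, so that agreement in degrees 0 and 1 propagates to
all degrees. -/
theorem radialProduct_add_two {r r' k : ℝ} (hr : r ≠ 0) (hr' : r' ≠ 0) (hk : k ≠ 0) (n : ℕ) :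
    k * r * r' * (radialProduct r r' (n + 2) k - radialProduct r r' n k)
      = -(2 * n + 3) * deriv (radialProduct r r' (n + 1)) k := by
  rw [(hasDerivAt_radialProduct hr hr' hk (n + 1)).deriv]
  simp only [radialProduct]
  have hrc : (r : ℂ) ≠ 0 := by exact_mod_cast hr
  have hrc' : (r' : ℂ) ≠ 0 := by exact_mod_cast hr'
  have hkc : (k : ℂ) ≠ 0 := by exact_mod_cast hk
  rw [show n + 1 + 1 = n + 2 from rfl, z4_add_two n (mul_ne_zero hk hr),
    z1_add_two n (mul_ne_zero hk hr')]
  push_cast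
  field_simp
  ring

theorem exp_neg_I_mul (x : ℂ) :
    Complex.exp (-(Complex.I * x)) = Complex.cos x - Complex.I * Complex.sin x := by
  rw [show -(Complex.I * x) = -x * Complex.I by ring, Complex.exp_mul_I, Complex.cos_neg,
    Complex.sin_neg]
  ring

theorem exp_neg_I_mul_sub (x y : ℂ) : Complex.exp (-(Complex.I * (x - y)))
    = Complex.exp (-(Complex.I * x)) * (Complex.cos y + Complex.I * Complex.sin y) := by
  rw [show -(Complex.I * (x - y)) = -(Complex.I * x) + y * Complex.I by ring, Complex.exp_add,
    Complex.exp_mul_I]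
  ring

theorem exp_neg_I_mul_add (x y : ℂ) : Complex.exp (-(Complex.I * (x + y)))
    = Complex.exp (-(Complex.I * x)) * (Complex.cos y - Complex.I * Complex.sin y) := by
  rw [← exp_neg_I_mul y, ← Complex.exp_add]
  ring_nf

theorem z4_zero_eq_exp {x : ℝ} (hx : x ≠ 0) :
    z4 0 x = Complex.I * Complex.exp (-(Complex.I * x)) / x := by
  rw [z4_zero hx, exp_neg_I_mul]
  linear_combination (Complex.sin x / x) * Complex.I_sq

theorem z4_one_eq_exp {x : ℝ} (hx : x ≠ 0) :
    z4 1 x = (Complex.I - x) * Complex.exp (-(Complex.I * x)) / x ^ 2 := by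
  rw [z4_one hx, exp_neg_I_mul]
  linear_combination (Complex.sin x / x ^ 2) * Complex.I_sq

theorem radialIntegral_zero {r r' : ℝ} (hr : r ≠ 0) (hr' : r' ≠ 0) {k : ℝ} (hk : k ≠ 0) :
    radialIntegral r r' 0 k = radialProduct r r' 0 k := by
  have hi := intervalIntegral.integral_eq_sub_of_hasDerivAt (a := r - r') (b := r + r')
    (fun s _ => hasDerivAt_exp_neg k s) (Continuous.intervalIntegrable (by fun_prop) _ _)
  rw [intervalIntegral.integral_const_mul] at hi
  have hrc : (r : ℂ) ≠ 0 := by exact_mod_cast hr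
  have hrc' : (r' : ℂ) ≠ 0 := by exact_mod_cast hr'
  have hkc : (k : ℂ) ≠ 0 := by exact_mod_cast hk
  refine mul_left_cancel₀ (mul_ne_zero Complex.I_ne_zero hkc) ?_
  simp only [radialIntegral, legendre_zero, eval_one, Complex.ofReal_one, one_mul, radialProduct]
  rw [z4_zero_eq_exp (mul_ne_zero hk hr), z1_zero (mul_ne_zero hk hr')]
  have ea : Complex.exp (-(Complex.I * k * ((r - r' : ℝ) : ℂ)))
      = Complex.exp (-(Complex.I * ((k * r : ℝ) : ℂ)))
        * (Complex.cos ((k * r' : ℝ) : ℂ) + Complex.I * Complex.sin ((k * r' : ℝ) : ℂ)) := by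
    rw [← exp_neg_I_mul_sub]; push_cast; ring_nf
  have eb : Complex.exp (-(Complex.I * k * ((r + r' : ℝ) : ℂ)))
      = Complex.exp (-(Complex.I * ((k * r : ℝ) : ℂ)))
        * (Complex.cos ((k * r' : ℝ) : ℂ) - Complex.I * Complex.sin ((k * r' : ℝ) : ℂ)) := by
    rw [← exp_neg_I_mul_add]; push_cast; ring_nf
  rw [ea, eb] at hi
  generalize Complex.exp (-(Complex.I * ((k * r : ℝ) : ℂ))) = E at *
  generalize Complex.cos ((k * r' : ℝ) : ℂ) = C at *
  generalize Complex.sin ((k * r' : ℝ) : ℂ) = S at *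
  have hrhs : 2 * (r : ℂ) * r' * (-Complex.I * k * (Complex.I * E / ((k * r : ℝ) : ℂ))
      * (S / ((k * r' : ℝ) : ℂ))) = 2 * E * S / k := by
    push_cast
    field_simp
    linear_combination (-E * S) * Complex.I_sq
  rw [hrhs]
  field_simp
  linear_combination Complex.I * hi + (k * (∫ s in (r - r')..(r + r'),
    Complex.exp (-(Complex.I * k * s))) - 2 * E * S) * Complex.I_sq

theorem radialIntegral_one {r r' : ℝ} (hr : r ≠ 0) (hr' : r' ≠ 0) {k : ℝ} (hk : k ≠ 0) :
    radialIntegral r r' 1 k = radialProduct r r' 1 k := by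
  have hrc : (r : ℂ) ≠ 0 := by exact_mod_cast hr
  have hrc' : (r' : ℂ) ≠ 0 := by exact_mod_cast hr'
  have hkc : (k : ℂ) ≠ 0 := by exact_mod_cast hk
  -- Differentiating the identity of degree 0 in k evaluates the first moment ∫ s exp(-iks) ds,
  -- called J below.
  have hd : deriv (radialIntegral r r' 0) k = deriv (radialProduct r r' 0) k := by
    refine Filter.EventuallyEq.deriv_eq ?_
    filter_upwards [isOpen_compl_singleton.mem_nhds hk] with x hx
      using radialIntegral_zero hr hr' hx
  rw [(hasDerivAt_radialIntegral r r' 0 k).deriv,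
    (hasDerivAt_radialProduct hr hr' hk 0).deriv] at hd
  simp only [legendre_zero, eval_one, Complex.ofReal_one, one_mul, zero_add, Nat.cast_zero,
    mul_zero] at hd
  have hcontX : Continuous fun s : ℝ => ((cosineLaw r r' s : ℝ) : ℂ)
      * Complex.exp (-(Complex.I * k * s)) :=
    (Complex.continuous_ofReal.comp (continuous_cosineLaw r r')).mul (by fun_prop)
  have hcontS : Continuous fun s : ℝ => (s : ℂ) * Complex.exp (-(Complex.I * k * s)) := by fun_prop
  -- The `- 0` fits the shape of `integral_mul_sub_mul_sub` with w = 0.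
  have hder (s : ℝ) : HasDerivAt (fun s : ℝ => ((cosineLaw r r' s : ℝ) : ℂ)
        * Complex.exp (-(Complex.I * k * s)))
      (-(1 / (r * r')) * (s * Complex.exp (-(Complex.I * k * s)))
        - Complex.I * k * (((cosineLaw r r' s : ℝ) : ℂ) * Complex.exp (-(Complex.I * k * s)) - 0))
      s := by
    refine ((hasDerivAt_cosineLaw r r' s).ofReal_comp.mul (hasDerivAt_exp_neg k s)).congr_deriv ?_
    push_cast
    ring
  have hi := intervalIntegral.integral_eq_sub_of_hasDerivAt (a := r - r') (b := r + r')
    (fun s _ => hder s) (Continuous.intervalIntegrable ((continuous_const.mul hcontS).sub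
      (continuous_const.mul (hcontX.sub continuous_const))) _ _)
  rw [integral_mul_sub_mul_sub hcontS hcontX continuous_const, cosineLaw_sub hr hr',
    cosineLaw_add hr hr', intervalIntegral.integral_zero, sub_zero] at hi
  refine mul_left_cancel₀ (mul_ne_zero Complex.I_ne_zero hkc) ?_
  simp only [radialIntegral, legendre_one, eval_X, radialProduct]
  rw [z4_zero_eq_exp (mul_ne_zero hk hr), z1_zero (mul_ne_zero hk hr'),
    z4_one_eq_exp (mul_ne_zero hk hr), z1_one (mul_ne_zero hk hr')] at hd
  rw [z4_one_eq_exp (mul_ne_zero hk hr), z1_one (mul_ne_zero hk hr')]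
  have ea : Complex.exp (-(Complex.I * k * ((r - r' : ℝ) : ℂ)))
      = Complex.exp (-(Complex.I * ((k * r : ℝ) : ℂ)))
        * (Complex.cos ((k * r' : ℝ) : ℂ) + Complex.I * Complex.sin ((k * r' : ℝ) : ℂ)) := by
    rw [← exp_neg_I_mul_sub]; push_cast; ring_nf
  have eb : Complex.exp (-(Complex.I * k * ((r + r' : ℝ) : ℂ)))
      = Complex.exp (-(Complex.I * ((k * r : ℝ) : ℂ)))
        * (Complex.cos ((k * r' : ℝ) : ℂ) - Complex.I * Complex.sin ((k * r' : ℝ) : ℂ)) := by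
    rw [← exp_neg_I_mul_add]; push_cast; ring_nf
  rw [ea, eb] at hi
  generalize Complex.exp (-(Complex.I * ((k * r : ℝ) : ℂ))) = E at *
  generalize Complex.cos ((k * r' : ℝ) : ℂ) = C at *
  generalize Complex.sin ((k * r' : ℝ) : ℂ) = S at *
  generalize (∫ s in (r - r')..(r + r'), (s : ℂ) * Complex.exp (-(Complex.I * k * s))) = J at *
  generalize (∫ s in (r - r')..(r + r'), ((cosineLaw r r' s : ℝ) : ℂ)
    * Complex.exp (-(Complex.I * k * s))) = G at *
  push_cast at hd hi ⊢
  have hJ : J = 2 * E / k ^ 2 * (k * r * S + Complex.I * k * r' * C - Complex.I * S) := by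
    refine mul_left_cancel₀ (neg_ne_zero.2 Complex.I_ne_zero) (hd.trans ?_)
    field_simp
    ring
  have hrhs : 2 * (r : ℂ) * r' * (-Complex.I * k
        * ((Complex.I - k * r) * E / (k * r) ^ 2) * -((k * r' * C - S) / (k * r') ^ 2))
      = 2 * Complex.I * E * (Complex.I - k * r) * (k * r' * C - S) / (k ^ 3 * r * r') := by
    field_simp
  rw [hrhs]
  rw [hJ] at hi
  field_simp at hi ⊢
  linear_combination Complex.I * hi + r * r' * k ^ 3 * G * Complex.I_sq

theorem radialIntegral_eq {r r' : ℝ} (hr : r ≠ 0) (hr' : r' ≠ 0) (n : ℕ) :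
    ∀ k ≠ 0, radialIntegral r r' n k = radialProduct r r' n k := by
  induction n using Nat.twoStepInduction with
  | zero => exact fun k hk => radialIntegral_zero hr hr' hk
  | one => exact fun k hk => radialIntegral_one hr hr' hk
  | more n ih0 ih1 =>
    intro k hk
    -- The induction hypothesis holds on the open set k ≠ 0, so it may be differentiated.
    have hd : deriv (radialIntegral r r' (n + 1)) k = deriv (radialProduct r r' (n + 1)) k := by
      refine Filter.EventuallyEq.deriv_eq ?_
      filter_upwards [isOpen_compl_singleton.mem_nhds hk] with x hx using ih1 x hx
    have h1 := radialIntegral_add_two hr hr' n k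
    have h2 := radialProduct_add_two hr hr' hk n
    rw [hd, ← h2, ih0 k hk] at h1
    have h3 : (k * r * r' : ℂ) ≠ 0 := by exact_mod_cast mul_ne_zero (mul_ne_zero hk hr) hr'
    exact sub_left_inj.1 (mul_left_cancel₀ h3 h1)

end RadialIntegral

/-! ### The Fourier transform of the kernel and its inversion in L². -/

section InverseFourier

/-- On `L¹ ∩ L²` the Fourier transform of `L²` is given by the Fourier integral. -/
theorem fourier_toLp_ae_eq {f : ℝ → ℂ} (hf1 : Integrable f) (hf2 : MemLp f 2 volume) :
    ((𝓕 (hf2.toLp f) : Lp ℂ 2 (volume : Measure ℝ)) : ℝ → ℂ) =ᵐ[volume] 𝓕 f := by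
  have hcont : Continuous (𝓕 f) :=
    VectorFourier.fourierIntegral_continuous Real.continuous_fourierChar
      (by exact continuous_inner) hf1
  -- Both sides are tested against smooth compactly supported g; each transform is moved onto g,
  -- once for distributions and once for integrable functions.
  refine ae_eq_of_integral_contDiff_smul_eq
    ((Lp.memLp _).locallyIntegrable one_le_two) hcont.locallyIntegrable fun g hg hgs => ?_
  set G : 𝓢(ℝ, ℂ) := (hgs.comp_left (g := fun x : ℝ => (x : ℂ)) (by simp)).toSchwartzMap
    (Complex.ofRealCLM.contDiff.comp hg) with hG
  have hGx (x : ℝ) : G x = (g x : ℂ) := rfl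
  have h := DFunLike.congr_fun
    (Lp.fourier_toTemperedDistribution_eq (hf2.toLp f : Lp ℂ 2 (volume : Measure ℝ))) G
  rw [TemperedDistribution.fourier_apply, Lp.toTemperedDistribution_apply,
    Lp.toTemperedDistribution_apply] at h
  simp only [hGx] at h
  calc ∫ x, g x • ((𝓕 (hf2.toLp f) : Lp ℂ 2 (volume : Measure ℝ)) : ℝ → ℂ) x
      = ∫ x, (g x : ℂ) • ((𝓕 (hf2.toLp f) : Lp ℂ 2 (volume : Measure ℝ)) : ℝ → ℂ) x := by
        simp
    _ = ∫ x, (𝓕 G : 𝓢(ℝ, ℂ)) x • (hf2.toLp f : ℝ → ℂ) x := h.symm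
    _ = ∫ x, (𝓕 (G : ℝ → ℂ)) x • f x := by
        refine integral_congr_ae ?_
        filter_upwards [hf2.coeFn_toLp] with x hx
        rw [hx, SchwartzMap.fourier_coe]
    _ = ∫ x, G x • 𝓕 f x := by
        have := VectorFourier.integral_fourierIntegral_smul_eq_flip (L := innerₗ ℝ)
          Real.continuous_fourierChar (by exact continuous_inner) (G.integrable (μ := volume)) hf1
        simpa using! this
    _ = ∫ x, g x • 𝓕 f x := by simp [hGx]

/-- With s = ct the transform becomes `radialIntegral` at k = 2πν/c. The assumption r' ≤ r makes the
lower limit |r - r'| equal to r - r', and the conjugation is idle because j_n is real. -/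
theorem fourier_kernelZero {c r r' : ℝ} (hc : 0 < c) (hr : 0 < r) (hr' : 0 < r') (hle : r' ≤ r)
    (n : ℕ) {ν : ℝ} (hν : ν ≠ 0) :
    𝓕 (fun t => (kernelZero c r r' n t : ℂ)) ν
      = -Complex.I * ((2 * Real.pi * ν / c : ℝ) : ℂ) * z4 n (2 * Real.pi * ν / c * r)
        * starRingEnd ℂ (z1 n (2 * Real.pi * ν / c * r')) := by
  set k : ℝ := 2 * Real.pi * ν / c with hk
  have hk0 : k ≠ 0 := by have := Real.pi_ne_zero; have := hc.ne'; positivity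
  have hrad := radialIntegral_eq hr.ne' hr'.ne' n k hk0
  have hrc : (r : ℂ) ≠ 0 := by exact_mod_cast hr.ne'
  have hrc' : (r' : ℂ) ≠ 0 := by exact_mod_cast hr'.ne'
  have hcc : (c : ℂ) ≠ 0 := by exact_mod_cast hc.ne'
  have hconj : starRingEnd ℂ (z1 n (k * r')) = z1 n (k * r') := Complex.conj_ofReal _
  rw [hconj, Real.fourier_eq']
  have h1 : (fun t : ℝ => Complex.exp (((-2 * Real.pi * inner ℝ t ν : ℝ) : ℂ) * Complex.I)
        • (kernelZero c r r' n t : ℂ))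
      = fun t => ((c / (2 * r * r') : ℝ) : ℂ) * (Complex.exp (-(Complex.I * k * ((c * t : ℝ) : ℂ)))
        * (legendrePulse c r r' n t : ℂ)) := by
    ext t
    have e : ((-2 * Real.pi * inner ℝ t ν : ℝ) : ℂ) * Complex.I
        = -(Complex.I * k * ((c * t : ℝ) : ℂ)) := by
      rw [hk]
      simp
      field_simp
    rw [e, kernelZero, smul_eq_mul]
    push_cast
    ring
  rw [h1, integral_const_mul, integral_mul_legendrePulse hc hr hr',
    abs_of_nonneg (sub_nonneg.2 hle)]
  have h2 := intervalIntegral.smul_integral_comp_mul_left (a := (r - r') / c) (b := (r + r') / c) c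
    (f := fun s : ℝ => (((legendre n).eval (cosineLaw r r' s) : ℝ) : ℂ)
      * Complex.exp (-(Complex.I * k * s)))
  rw [mul_div_cancel₀ _ hc.ne', mul_div_cancel₀ _ hc.ne'] at h2
  have h3 : (c : ℝ) • (∫ t in (r - r') / c..(r + r') / c,
      Complex.exp (-(Complex.I * k * ((c * t : ℝ) : ℂ))) * (((legendre n).eval
        ((r ^ 2 + r' ^ 2 - c ^ 2 * t ^ 2) / (2 * r * r')) : ℝ) : ℂ)) = radialProduct r r' n k := by
    rw [← hrad, radialIntegral, ← h2]
    congr 2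
    ext t
    rw [cosineLaw, mul_pow, mul_comm]
  rw [Complex.real_smul, radialProduct] at h3
  generalize (∫ t in (r - r') / c..(r + r') / c,
    Complex.exp (-(Complex.I * k * ((c * t : ℝ) : ℂ))) * (((legendre n).eval
      ((r ^ 2 + r' ^ 2 - c ^ 2 * t ^ 2) / (2 * r * r')) : ℝ) : ℂ)) = J at *
  generalize z4 n (k * r) = a at *
  generalize z1 n (k * r') = b at *
  push_cast
  field_simp
  linear_combination h3

/-- The kernel is in L¹ ∩ L², so its L² transform is the Fourier integral almost everywhere. The
point ν = 0, where `z4` has no meaningful value, is negligible. The given function thus equals an L²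
function almost everywhere, which makes it square integrable, and L² inversion returns the kernel.
-/
theorem isInverseFourierTransform_kernelZero {c r r' : ℝ} (hc : 0 < c) (hr : 0 < r)
    (hr' : 0 < r') (hle : r' ≤ r) (n : ℕ) :
    IsInverseFourierTransform
      (fun ω => -Complex.I * ((ω / c : ℝ) : ℂ) * z4 n (ω / c * r)
        * starRingEnd ℂ (z1 n (ω / c * r')))
      (fun t => (kernelZero c r r' n t : ℂ)) := by
  have hf2 : MemLp (fun t => (kernelZero c r r' n t : ℂ)) 2 volume := by
    have := (memLp_legendrePulse c r r' n).const_mul ((c / (2 * r * r') : ℝ) : ℂ)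
    simpa [kernelZero] using! this
  have hf1 : Integrable (fun t => (kernelZero c r r' n t : ℂ)) := by
    have hr := (hf2.restrict (Set.Icc (|r - r'| / c) ((r + r') / c)))
    have : IsFiniteMeasure (volume.restrict (Set.Icc (|r - r'| / c) ((r + r') / c))) :=
      ⟨by simp⟩
    have h1 : IntegrableOn (fun t => (kernelZero c r r' n t : ℂ))
      (Set.Icc (|r - r'| / c) ((r + r') / c)) := hr.integrable (by norm_num)
    refine (integrableOn_iff_integrable_of_support_subset fun t ht => ?_).1 h1
    by_contra hcon
    exact ht (by simp [kernelZero, legendrePulse, pulse, Set.indicator_of_notMem hcon])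
  have hae : ((𝓕 (hf2.toLp _) : Lp ℂ 2 (volume : Measure ℝ)) : ℝ → ℂ) =ᵐ[volume]
      fun ν : ℝ => -Complex.I * ((2 * Real.pi * ν / c : ℝ) : ℂ) * z4 n (2 * Real.pi * ν / c * r)
        * starRingEnd ℂ (z1 n (2 * Real.pi * ν / c * r')) := by
    have h0 : ∀ᵐ ν : ℝ, ν ≠ 0 := by simp [ae_iff]
    filter_upwards [fourier_toLp_ae_eq hf1 hf2, h0] with ν hν hν0
    rw [hν, fourier_kernelZero hc hr hr' hle n hν0]
  have hF : MemLp (fun ν : ℝ => -Complex.I * ((2 * Real.pi * ν / c : ℝ) : ℂ)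
      * z4 n (2 * Real.pi * ν / c * r) * starRingEnd ℂ (z1 n (2 * Real.pi * ν / c * r')))
      2 volume := (Lp.memLp _).ae_eq hae
  refine ⟨hF, hf2, ?_⟩
  have h : (hF.toLp _ : Lp ℂ 2 (volume : Measure ℝ)) = 𝓕 (hf2.toLp _) :=
    Lp.ext (hF.coeFn_toLp.trans hae.symm)
  rw [h]
  exact FourierTransform.fourierInv_fourier_eq _

end InverseFourier

end SphericalWave

end

theorem mainTheorem1 (c r r' : ℝ) (hc : 0 < c) (hr : 0 < r) (hr' : 0 < r') :
    -- the expansion of the retarded potential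
    (r ≠ r' → ∀ θ ∈ Set.Icc 0 Real.pi, ∀ θ' ∈ Set.Icc 0 Real.pi, ∀ φ φ' : ℝ,
      let p := SphericalWave.sphericalPoint r θ φ
      let q := SphericalWave.sphericalPoint r' θ' φ'
      HasSum (fun n : ℕ =>
          (((2 * n + 1) * c / (8 * Real.pi * r * r')
              * (SphericalWave.legendre n).eval (Real.cos (InnerProductGeometry.angle p q)) : ℝ) : ℂ)
            • SphericalWave.legendrePulseDistribution c r r' n)
        (SphericalWave.retardedPotential c (dist p q)) ∧
      HasSum (fun n : ℕ => ∑ m ∈ Finset.Icc (-(n : ℤ)) n,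
          (((c / (2 * r * r') : ℝ) : ℂ) * SphericalWave.sphericalHarmonic n m θ φ
              * starRingEnd ℂ (SphericalWave.sphericalHarmonic n m θ' φ'))
            • SphericalWave.legendrePulseDistribution c r r' n)
        (SphericalWave.retardedPotential c (dist p q))) ∧
    -- the inverse Fourier transform, with `k = ω / c`
    (r' ≤ r → ∀ n : ℕ, SphericalWave.IsInverseFourierTransform
      (fun ω => -Complex.I * ((ω / c : ℝ) : ℂ) * SphericalWave.z4 n (ω / c * r)
        * starRingEnd ℂ (SphericalWave.z1 n (ω / c * r')))
      (fun t => (SphericalWave.kernelZero c r r' n t : ℂ))) ∧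
    -- the kernel is bounded and compactly supported
    (∀ n : ℕ, (∀ t, |SphericalWave.kernelZero c r r' n t| ≤ c / (2 * r * r')) ∧
      HasCompactSupport (SphericalWave.kernelZero c r r' n)) := by
  refine ⟨fun hne θ hθ θ' hθ' φ φ' => ⟨?_, ?_⟩, fun hle n => ?_, fun n => ⟨?_, ?_⟩⟩
  · exact SphericalWave.hasSum_retardedPotential_legendre hc hr hr' hne θ θ' φ φ'
  · exact SphericalWave.hasSum_retardedPotential_sphericalHarmonic hc hr hr' hne hθ hθ' φ φ'
  · exact SphericalWave.isInverseFourierTransform_kernelZero hc hr hr' hle n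
  · exact SphericalWave.abs_kernelZero_le hc hr hr' n
  · exact SphericalWave.hasCompactSupport_kernelZero c r r' n
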